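/- For $0<\vartheta<\pi/2$ and $r>1$ let $\Delta(\vartheta,r)=\{z\in\mathbb C : |z|<r,\ z\neq 1,\ \vartheta<\operatorname{Arg}(z-1)<2\pi-\vartheta\}$ (with $\operatorname{Arg}\in[0,2\pi)$), and for $a,b\in\mathbb C$ let $\sigma_{a,b}(z)=(1-z)^{-a}\left(\frac1z\log\frac1{1-z}\right)^{b}$ (principal determinations, $z$ near $1$). For elements $\sigma,\omega$ of the scale $\mathcal S=\{\sigma_{a,b}: a,b\in\mathbb C\}$ write $\sigma\succ\omega$ if $\omega(z)=o(\sigma(z))$ as $z\to1$ in the given domain. A function $f$ on the open unit disc is *of S.A. type* if, for some $\vartheta\in(0,\pi/2)$ and $r>1$, it has an analytic continuation $F$ to $\Delta(\vartheta,r)$ that admits there a singular expansion in the scale $\mathcal S$: there are coefficients $c_{a,b}\in\mathbb C$ $(a,b\in\mathbb C)$ such that, for every $\omega\in\mathcal S$, only finitely many pairs $(a,b)$ satisfy both $c_{a,b}\neq0$ and $\sigma_{a,b}\succ\omega$, and $$F(z)=\sum_{\substack{c_{a,b}\ne0\\ \sigma_{a,b}\succ\omega}}c_{a,b}\,\sigma_{a,b}(z)+O(\omega(z))\qquad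 (z\to1,\ z\in\Delta(\vartheta,r)).$$ **Theorem.** Let $\alpha\in\mathbb C$ and $k\in\mathbb Z_{\ge0}$. Then the series $\operatorname{Li}_{\alpha,k}(z)=\sum_{n\ge1}(\log n)^k n^{-\alpha}z^n$ converges for $|z|<1$, and the function $\operatorname{Li}_{\alpha,k}$ is of S.A. type. -/

import Mathlib

open Filter Topology Asymptotics

namespace SingularityAnalysis

/-- The indented disc `Δ(ϑ, r)`: `|z| < r`, `z ≠ 1`, and `ϑ < Arg (z - 1) < 2π - ϑ` for the
determination `Arg ∈ [0, 2π)`. In terms of the principal argument in `(-π, π]` the last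
condition reads `ϑ < |arg (z - 1)|`. -/
def deltaDomain (ϑ r : ℝ) : Set ℂ :=
  {z | ‖z‖ < r ∧ z ≠ 1 ∧ ϑ < |Complex.arg (z - 1)|}

/-- The basic scale `σ_{α,β}(z) = (1 - z)^{-α} ((1/z) log (1 - z)⁻¹)^β`, with `p = (α, β) ∈ ℂ²`
and principal determinations. (Only the behaviour as `z → 1` is used.) -/
noncomputable def scale (p : ℂ × ℂ) (z : ℂ) : ℂ :=
  (1 - z) ^ (-p.1) * (1 / z * Complex.log (1 - z)⁻¹) ^ p.2

/-- `σ_p ≻ σ_q` as `z → 1` inside `D`: the element `σ_q` is negligible compared with `σ_p`. -/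
def Dominates (D : Set ℂ) (p q : ℂ × ℂ) : Prop :=
  scale q =o[𝓝[D] 1] scale p

/-- `F` has, as `z → 1` inside `D`, the (full) singular expansion `∑ c_p σ_p` in the basic scale:
for every element `ω` of the scale, only finitely many terms with `c_p ≠ 0` satisfy `σ_p ≻ ω`,
and `F` is their sum up to an error `O(ω)`. -/
def HasSingularExpansion (F : ℂ → ℂ) (D : Set ℂ) (c : ℂ × ℂ → ℂ) : Prop :=
  ∀ ω : ℂ × ℂ, ∃ T : Finset (ℂ × ℂ),
    (∀ p, p ∈ T ↔ c p ≠ 0 ∧ Dominates D p ω) ∧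
    (fun z => F z - ∑ p ∈ T, c p * scale p z) =O[𝓝[D] 1] scale ω

/-- A function `f` on the open unit disc is amenable to singularity analysis (of S.A. type) if it
continues analytically to some `Δ`-domain and its continuation admits there a singular expansion
at `z = 1` in the basic scale. (Every `Δ`-domain contains the open unit disc.) -/
def IsSAType (f : ℂ → ℂ) : Prop :=
  ∃ ϑ r : ℝ, 0 < ϑ ∧ ϑ < Real.pi / 2 ∧ 1 < r ∧
    ∃ F : ℂ → ℂ, AnalyticOnNhd ℂ F (deltaDomain ϑ r) ∧
      (∀ z : ℂ, ‖z‖ < 1 → F z = f z) ∧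
      ∃ c : ℂ × ℂ → ℂ, HasSingularExpansion F (deltaDomain ϑ r) c

/-- The term `(log n)^k n^{-α} z^n` of the generalized polylogarithm, with `n` replaced by
`n + 1`, so that `n` runs over all natural numbers. -/
noncomputable def polylogTerm (α : ℂ) (k : ℕ) (z : ℂ) (n : ℕ) : ℂ :=
  (Real.log ((n + 1 : ℕ) : ℝ) : ℂ) ^ k * ((n + 1 : ℕ) : ℂ) ^ (-α) * z ^ (n + 1)

/-- The generalized polylogarithm `Li_{α,k}(z) = ∑_{n ≥ 1} (log n)^k n^{-α} z^n`, `|z| < 1`. -/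
noncomputable def polylog (α : ℂ) (k : ℕ) (z : ℂ) : ℂ :=
  ∑' n : ℕ, polylogTerm α k z n

end SingularityAnalysis

/-! For `Re β > 0`, the integral of `t ^ β (log t) ^ j e ^ (-n t)` over `(0, ∞)` is `n ^ (-β - 1)`
times a polynomial in `log n` of degree `j`, with leading coefficient `(-1) ^ j Γ(β + 1) ≠ 0`.
Multiplying by `z ^ n` and summing shows that `boseIntegral β j` is a triangular combination of the
`Li_{β+1,i}`, `i ≤ j` (`boseIntegral_eq_sum`). The integral is holomorphic off `[1, ∞)`, so solving
the triangular system continues `Li_{α,k}` there when `Re α > 1`. The operator `z d/dz` lowers `α`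
by one and so reaches every `α` (`HasPolylogContinuation.sub_one`).

For the singularity, put `z = e ^ (-w)`. The kernel becomes `1 / (e ^ (t + w) - 1)`, which is `1 /
(t + w)` plus a regular term for `t ≤ 1`, and the tail `t > 1` is analytic at `w = 0`. What remains
is `S_j(w) = ∫_0^1 t ^ β (log t) ^ j / (t + w) dt`. Integration by parts gives `(w d/dw - β) S_j = j
S_{j-1}` for `j ≥ 1` and `(w d/dw - β) S_0 = -1 / (1 + w)`. An explicit power series absorbs the
inhomogeneity, up to a resonant multiple of `w ^ β`, so `S_j` is analytic plus `w ^ β Q(log w)` with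
`Q` a polynomial (`stieltjes_eq`).

Finally `w = -log z = x g(x)` with `x = 1 - z`, `g` analytic and `g(0) = 1`. In a `Δ`-domain `log w
= log x + log g(x)` near `1`, so the continuation is a finite sum of analytic functions of `x` times
scale elements. Taylor's formula expands each product (`exists_hasSingularExpansion_mul_scale`).
Growth compares any two scale elements, hence truncation at any `ω` is possible. -/

namespace SingularityAnalysis

open MeasureTheory Metric Set

/-! ### Differentiation of power series and of parameter integrals. -/

/-- Termwise Euler derivative of a power series converging absolutely in the unit disc. -/
theorem differentiableAt_powerSeries {a : ℕ → ℂ}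
    (ha : ∀ r : ℝ, 0 ≤ r → r < 1 → Summable fun n : ℕ => ‖a n‖ * r ^ n) {z : ℂ} (hz : ‖z‖ < 1) :
    DifferentiableAt ℂ (fun z => ∑' n, a n * z ^ n) z ∧
      z * deriv (fun z => ∑' n, a n * z ^ n) z = ∑' n : ℕ, (n : ℂ) * a n * z ^ n := by
  obtain ⟨r, hzr, hr⟩ := exists_between hz
  have hu := ha r ((norm_nonneg z).trans hzr.le) hr
  have hd : ∀ n : ℕ, DifferentiableOn ℂ (fun z : ℂ => a n * z ^ n) (ball 0 r) := fun n =>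
    (by fun_prop : Differentiable ℂ fun z : ℂ => a n * z ^ n).differentiableOn
  have hle : ∀ (n : ℕ) (w : ℂ), w ∈ ball (0 : ℂ) r → ‖a n * w ^ n‖ ≤ ‖a n‖ * r ^ n := by
    intro n w hw
    rw [norm_mul, norm_pow]
    have : ‖w‖ ≤ r := (mem_ball_zero_iff.1 hw).le
    gcongr
  have hz' : z ∈ ball (0 : ℂ) r := mem_ball_zero_iff.2 hzr
  refine ⟨(Complex.differentiableOn_tsum_of_summable_norm hu hd isOpen_ball hle).differentiableAt
    (isOpen_ball.mem_nhds hz'), ?_⟩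
  rw [← (Complex.hasSum_deriv_of_summable_norm hu hd isOpen_ball hle hz').tsum_eq, ← tsum_mul_left]
  refine tsum_congr fun n => ?_
  rw [deriv_const_mul _ (by fun_prop)]
  cases n with
  | zero => simp
  | succ n => rw [(hasDerivAt_pow (n + 1) z).deriv, Nat.add_sub_cancel]; ring

/-- A uniform bound on a kernel holomorphic in the parameter suffices: Cauchy's estimate on discs of
radius `ε / 2` bounds the derivative by `C / (ε / 2)`, which gives the dominating function. -/
theorem hasDerivAt_integral_kernel {μ : Measure ℝ} {φ : ℝ → ℂ} (hφ : Integrable φ μ)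
    {K : ℂ → ℝ → ℂ} {z₀ : ℂ} {ε C : ℝ} (hε : 0 < ε)
    (hm : ∀ z ∈ ball z₀ ε, AEStronglyMeasurable (K z) μ)
    (hd : ∀ᵐ t ∂μ, DifferentiableOn ℂ (fun z => K z t) (ball z₀ ε))
    (hb : ∀ᵐ t ∂μ, ∀ z ∈ ball z₀ ε, ‖K z t‖ ≤ C) :
    Integrable (fun t => φ t * deriv (fun z => K z t) z₀) μ ∧
    HasDerivAt (fun z => ∫ t, φ t * K z t ∂μ) (∫ t, φ t * deriv (fun z => K z t) z₀ ∂μ) z₀ := by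
  have h0 : z₀ ∈ ball z₀ ε := mem_ball_self hε
  have hmd : AEStronglyMeasurable (fun t => deriv (fun z => K z t) z₀) μ := by
    -- The derivative in the parameter is measurable in `t` as a limit of difference quotients along
    -- `h n → 0`, with all points `z₀ + h n` inside the ball.
    set h : ℕ → ℂ := fun n => (ε : ℂ) / 2 * ((n : ℂ) + 1)⁻¹ with hh
    have hn : ∀ n, h n ≠ 0 := fun n => by
      have : (n : ℂ) + 1 ≠ 0 := by exact_mod_cast n.succ_ne_zero
      simp [hh, hε.ne', this]
    have hlim : Tendsto h atTop (𝓝 0) := by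
      have : Tendsto (fun n : ℕ => 1 / ((n : ℂ) + 1)) atTop (𝓝 0) :=
        tendsto_one_div_add_atTop_nhds_zero_nat
      simpa [hh] using this.const_mul ((ε : ℂ) / 2)
    have hball : ∀ n, z₀ + h n ∈ ball z₀ ε := fun n => by
      rw [mem_ball, dist_eq_norm, add_sub_cancel_left, hh]
      have : ‖(n : ℂ) + 1‖ = n + 1 := by
        rw [show (n : ℂ) + 1 = ((n + 1 : ℕ) : ℂ) by push_cast; ring, Complex.norm_natCast]
        push_cast; ring
      simp only [norm_mul, norm_inv, norm_div, Complex.norm_real, Real.norm_eq_abs,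
        abs_of_pos hε, this, Complex.norm_ofNat]
      have h1 : ((n : ℝ) + 1)⁻¹ ≤ 1 := inv_le_one_of_one_le₀ (by linarith [n.cast_nonneg (α := ℝ)])
      nlinarith
    refine aestronglyMeasurable_of_tendsto_ae atTop
      (f := fun n t => (h n)⁻¹ • (K (z₀ + h n) t - K z₀ t))
      (fun n => ((hm _ (hball n)).fun_sub (hm _ h0)).fun_const_smul _) ?_
    filter_upwards [hd] with t ht
    have := (ht.differentiableAt (isOpen_ball.mem_nhds h0)).hasDerivAt
    rw [hasDerivAt_iff_tendsto_slope_zero] at this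
    exact this.comp (tendsto_nhdsWithin_iff.2 ⟨hlim, Eventually.of_forall hn⟩)
  refine hasDerivAt_integral_of_dominated_loc_of_deriv_le (s := ball z₀ (ε / 2))
    (bound := fun t => ‖φ t‖ * (C / (ε / 2)))
    (F' := fun z t => φ t * deriv (fun z => K z t) z)
    (ball_mem_nhds _ (by positivity)) ?_ ?_ (hφ.1.mul hmd) ?_ (hφ.norm.mul_const _) ?_
  · filter_upwards [ball_mem_nhds z₀ hε] with z hz using hφ.1.mul (hm z hz)
  · refine Integrable.mul_bdd (c := C) hφ (hm _ h0) ?_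
    filter_upwards [hb] with t ht using ht _ h0
  · filter_upwards [hd, hb] with t ht hbt z hz
    rw [norm_mul]
    refine mul_le_mul_of_nonneg_left ?_ (norm_nonneg _)
    have hsub : closedBall z (ε / 2) ⊆ ball z₀ ε := fun w hw => by
      rw [mem_closedBall] at hw; rw [mem_ball] at hz ⊢
      linarith [dist_triangle w z z₀]
    refine Complex.norm_deriv_le_of_forall_mem_sphere_norm_le (by positivity)
      (DifferentiableOn.diffContOnCl ?_) fun w hw => hbt w (hsub (sphere_subset_closedBall hw))
    exact ht.mono (closure_ball_subset_closedBall.trans hsub)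
  · filter_upwards [hd] with t ht z hz
    exact ((ht.differentiableAt (isOpen_ball.mem_nhds
      (ball_subset_ball (by linarith) hz))).hasDerivAt).const_mul _

/-! ### The integrand and its integrability. -/

/-- The integrand `t ^ β (log t) ^ j`. -/
noncomputable def powLog (β : ℂ) (j : ℕ) (t : ℝ) : ℂ := (t : ℂ) ^ β * (Real.log t : ℂ) ^ j

theorem continuousOn_powLog {β : ℂ} (hβ : 0 < β.re) (j : ℕ) :
    ContinuousOn (powLog β j) (Ici 0) := by
  intro t ht
  rcases (mem_Ici.1 ht).eq_or_lt with rfl | ht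
  · have h0 : powLog β j 0 = 0 := by
      have : β ≠ 0 := fun h => by simp [h] at hβ
      simp [powLog, this]
    rw [← Ioi_insert, continuousWithinAt_insert_self, ContinuousWithinAt, h0,
      tendsto_zero_iff_norm_tendsto_zero]
    have := (isLittleO_abs_log_rpow_rpow_nhdsGT_zero (j : ℝ)
      (neg_lt_zero.2 hβ)).tendsto_div_nhds_zero
    refine this.congr' ?_
    filter_upwards [self_mem_nhdsWithin] with x hx
    have hx : 0 < x := hx
    rw [powLog, norm_mul, Complex.norm_cpow_eq_rpow_re_of_pos hx, norm_pow, Complex.norm_real,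
      Real.norm_eq_abs, Real.rpow_neg hx.le, div_inv_eq_mul, Real.rpow_natCast, mul_comm]
  · refine ContinuousAt.continuousWithinAt ?_
    unfold powLog
    refine ContinuousAt.mul ?_ ?_
    · exact (Complex.continuousAt_ofReal_cpow_const t β (Or.inr ht.ne'))
    · exact (Complex.continuous_ofReal.continuousAt.comp
        (Real.continuousAt_log ht.ne')).pow j

theorem norm_powLog_le {β : ℂ} (j : ℕ) {t : ℝ} (ht : 1 ≤ t) :
    ‖powLog β j t‖ ≤ t ^ (β.re + j) := by
  have h0 : 0 < t := by linarith
  rw [powLog, norm_mul, Complex.norm_cpow_eq_rpow_re_of_pos h0, norm_pow, Complex.norm_real,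
      Real.norm_eq_abs, Real.rpow_add h0, Real.rpow_natCast, abs_of_nonneg (Real.log_nonneg ht)]
  gcongr
  · exact Real.log_nonneg ht
  · linarith [Real.log_le_sub_one_of_pos h0]

theorem integrableOn_powLog_mul_exp {β : ℂ} (hβ : 0 < β.re) (j : ℕ) {c : ℝ} (hc : 0 < c) :
    IntegrableOn (fun t => powLog β j t * (Real.exp (-(c * t)) : ℂ)) (Ioi 0) := by
  have hcont : ContinuousOn (fun t => powLog β j t * (Real.exp (-(c * t)) : ℂ)) (Ici 0) :=
    (continuousOn_powLog hβ j).mul (by fun_prop)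
  refine (integrable_norm_iff
    ((hcont.mono Ioi_subset_Ici_self).aestronglyMeasurable measurableSet_Ioi)).1 ?_
  refine integrable_of_isBigO_exp_neg (b := c / 2) (by positivity) hcont.norm ?_
  · have h1 : powLog β j =O[atTop] fun t : ℝ => Real.exp (c / 2 * t) := by
      refine IsBigO.trans (g := fun t : ℝ => t ^ (β.re + j)) ?_
        (isLittleO_rpow_exp_pos_mul_atTop _ (by positivity)).isBigO
      refine IsBigO.of_bound 1 ?_
      filter_upwards [eventually_ge_atTop 1] with t ht
      rw [one_mul]
      exact (norm_powLog_le j ht).trans (le_abs_self _)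
    have h2 := h1.mul (isBigO_refl (fun t : ℝ => (Real.exp (-(c * t)) : ℂ)) atTop).norm_right
    refine h2.norm_left.trans (IsBigO.of_bound 1 (Eventually.of_forall fun t => ?_))
    simp only [norm_mul, Complex.norm_real, Real.norm_eq_abs, Real.abs_exp]
    rw [← Real.exp_add, one_mul]
    apply le_of_eq; congr 1; ring

theorem exists_pos_le_norm_of_isCompact {X : Type*} [TopologicalSpace X] {S : Set X}
    (hS : IsCompact S) {f : X → ℂ} (hf : ContinuousOn f S) (h0 : ∀ x ∈ S, f x ≠ 0) :
    ∃ c : ℝ, 0 < c ∧ ∀ x ∈ S, c ≤ ‖f x‖ := by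
  rcases S.eq_empty_or_nonempty with rfl | hne
  · exact ⟨1, one_pos, by simp⟩
  · obtain ⟨x, hx, hmin⟩ := hS.exists_isMinOn hne hf.norm
    exact ⟨‖f x‖, norm_pos_iff.2 (h0 x hx), fun y hy => hmin hy⟩

/-! ### The Stieltjes transform and its Euler equation. -/

/-- The truncated Stieltjes transform of `t ^ β (log t) ^ j`. -/
noncomputable def stieltjes (β : ℂ) (j : ℕ) (w : ℂ) : ℂ :=
  ∫ t in Ioc (0 : ℝ) 1, powLog β j t * ((t : ℂ) + w)⁻¹

theorem add_ne_zero_of_mem_slitPlane {w : ℂ} (hw : w ∈ Complex.slitPlane) {t : ℝ} (ht : 0 ≤ t) :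
    (t : ℂ) + w ≠ 0 := by
  intro h
  have : w = ((-t : ℝ) : ℂ) := by push_cast; linear_combination h
  rw [this, Complex.ofReal_mem_slitPlane] at hw
  linarith

theorem integrableOn_powLog {β : ℂ} (hβ : 0 < β.re) (j : ℕ) :
    IntegrableOn (powLog β j) (Ioc 0 1) :=
  (((continuousOn_powLog hβ j).mono Icc_subset_Ici_self).integrableOn_Icc).mono_set
    Ioc_subset_Icc_self

theorem hasDerivAt_stieltjes_aux {β : ℂ} (hβ : 0 < β.re) (j : ℕ) {w : ℂ}
    (hw : w ∈ Complex.slitPlane) :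
    HasDerivAt (stieltjes β j)
      (∫ t in Ioc (0 : ℝ) 1, powLog β j t * (-(((t : ℂ) + w) ^ 2)⁻¹)) w := by
  obtain ⟨c, hc, hcb⟩ := exists_pos_le_norm_of_isCompact (isCompact_Icc (α := ℝ) (a := 0) (b := 1))
    (f := fun t : ℝ => (t : ℂ) + w) (by fun_prop)
    fun t ht => add_ne_zero_of_mem_slitPlane hw ht.1
  have hb : ∀ t ∈ Ioc (0 : ℝ) 1, ∀ z ∈ ball w (c / 2), c / 2 ≤ ‖(t : ℂ) + z‖ := by
    intro t ht z hz
    have h1 := hcb t ⟨ht.1.le, ht.2⟩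
    rw [mem_ball, dist_eq_norm] at hz
    have h2 : ‖(t : ℂ) + w‖ ≤ ‖(t : ℂ) + z‖ + ‖z - w‖ := by
      rw [show (t : ℂ) + w = (t + z) - (z - w) by ring]; exact norm_sub_le _ _
    linarith
  have hne : ∀ t ∈ Ioc (0 : ℝ) 1, ∀ z ∈ ball w (c / 2), (t : ℂ) + z ≠ 0 := fun t ht z hz =>
    norm_pos_iff.1 (by linarith [hb t ht z hz])
  have key := (hasDerivAt_integral_kernel (μ := volume.restrict (Ioc 0 1))
    (φ := powLog β j) (integrableOn_powLog hβ j) (K := fun z t => ((t : ℂ) + z)⁻¹) (z₀ := w)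
    (ε := c / 2) (C := (c / 2)⁻¹) (by positivity) ?_ ?_ ?_).2
  · refine HasDerivAt.congr_deriv (f := stieltjes β j) key ?_
    refine setIntegral_congr_fun measurableSet_Ioc fun t ht => ?_
    have h := ((hasDerivAt_id w).const_add (t : ℂ)).inv
      (hne t ht w (mem_ball_self (by positivity)))
    have h' : deriv (fun z : ℂ => ((t : ℂ) + z)⁻¹) w = -1 / ((t : ℂ) + w) ^ 2 := h.deriv
    simp only [h', neg_div, one_div]
  · intro z hz
    exact (by fun_prop : Measurable fun t : ℝ => ((t : ℂ) + z)⁻¹).aestronglyMeasurable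
  · refine (ae_restrict_iff' measurableSet_Ioc).2 (Eventually.of_forall fun t ht z hz => ?_)
    exact ((differentiableAt_id.const_add (t : ℂ)).inv (hne t ht z hz)).differentiableWithinAt
  · refine (ae_restrict_iff' measurableSet_Ioc).2 (Eventually.of_forall fun t ht z hz => ?_)
    rw [norm_inv]
    exact inv_anti₀ (by positivity) (hb t ht z hz)

theorem hasDerivAt_mul_powLog (β : ℂ) (j : ℕ) {t : ℝ} (ht : 0 < t) :
    HasDerivAt (fun t : ℝ => (t : ℂ) * powLog β j t)
      ((β + 1) * powLog β j t + j * powLog β (j - 1) t) t := by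
  have ht' : (t : ℂ) ≠ 0 := by exact_mod_cast ht.ne'
  have hid : HasDerivAt (fun t : ℝ => (t : ℂ)) 1 t := (hasDerivAt_id (t : ℂ)).comp_ofReal
  have hpow : HasDerivAt (fun t : ℝ => (t : ℂ) ^ β) (β * (t : ℂ) ^ (β - 1) * 1) t :=
    ((hasDerivAt_id (t : ℂ)).cpow_const (c := β)
      (Or.inl (by simpa using ht))).comp_ofReal
  have hlog : HasDerivAt (fun t : ℝ => (Real.log t : ℂ)) ((t⁻¹ : ℝ) : ℂ) t :=
    (Real.hasDerivAt_log ht.ne').ofReal_comp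
  have := hid.mul (hpow.mul (hlog.pow j))
  refine this.congr_deriv ?_
  rw [Complex.cpow_sub _ _ ht', Complex.cpow_one]
  simp only [powLog, Pi.pow_apply, Pi.mul_apply]
  push_cast
  field_simp
  ring

/-- Integrate the derivative of `t * powLog β j t / (t + w)` over `[0, 1]`, writing `t = (t + w) -
w`. The boundary term at `1` contains `(log 1) ^ j = 0 ^ j`, so it survives only for `j = 0`; there
the truncated index `j - 1` is harmless because of the factor `j`. -/
theorem stieltjes_euler {β : ℂ} (hβ : 0 < β.re) (j : ℕ) {w : ℂ}
    (hw : w ∈ Complex.slitPlane) :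
    ∃ d, HasDerivAt (stieltjes β j) d w ∧
      w * d - β * stieltjes β j w = j * stieltjes β (j - 1) w - 0 ^ j * (1 + w)⁻¹ := by
  refine ⟨_, hasDerivAt_stieltjes_aux hβ j hw, ?_⟩
  have hne : ∀ t : ℝ, 0 ≤ t → (t : ℂ) + w ≠ 0 := fun t ht => add_ne_zero_of_mem_slitPlane hw ht
  have hinv : ContinuousOn (fun t : ℝ => ((t : ℂ) + w)⁻¹) (Icc 0 1) :=
    ContinuousOn.inv₀ (by fun_prop) fun t ht => hne t ht.1
  have hp : ∀ i, ContinuousOn (powLog β i) (Icc 0 1) := fun i =>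
    (continuousOn_powLog hβ i).mono Icc_subset_Ici_self
  have hint : ∀ f : ℝ → ℂ, ContinuousOn f (Icc 0 1) → IntegrableOn f (Ioc 0 1) := fun f hf =>
    hf.integrableOn_Icc.mono_set Ioc_subset_Icc_self
  have hA : IntegrableOn (fun t : ℝ => powLog β j t * ((t : ℂ) + w)⁻¹) (Ioc 0 1) :=
    hint _ ((hp j).mul hinv)
  have hB : IntegrableOn (fun t : ℝ => powLog β (j - 1) t * ((t : ℂ) + w)⁻¹) (Ioc 0 1) :=
    hint _ ((hp (j - 1)).mul hinv)
  have hC : IntegrableOn (fun t : ℝ => powLog β j t * (-(((t : ℂ) + w) ^ 2)⁻¹)) (Ioc 0 1) := by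
    simp_rw [← inv_pow]
    exact hint _ ((hp j).mul (hinv.pow 2).neg)
  have hsum := ((hA.const_mul β).add (hB.const_mul (j : ℂ))).sub (hC.const_mul w)
  have hftc := intervalIntegral.integral_eq_sub_of_hasDerivAt_of_le (zero_le_one' ℝ)
    (f := fun t : ℝ => (t : ℂ) * powLog β j t * ((t : ℂ) + w)⁻¹)
    (f' := fun t : ℝ => β * (powLog β j t * ((t : ℂ) + w)⁻¹) +
      j * (powLog β (j - 1) t * ((t : ℂ) + w)⁻¹) - w * (powLog β j t * (-(((t : ℂ) + w) ^ 2)⁻¹)))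
    (((Complex.continuous_ofReal.continuousOn).mul (hp j)).mul hinv) (fun t ht => ?_)
    ((intervalIntegrable_iff_integrableOn_Ioc_of_le zero_le_one).2 hsum)
  · rw [intervalIntegral.integral_of_le zero_le_one,
      integral_sub ((hA.const_mul β).fun_add (hB.const_mul (j : ℂ))) (hC.const_mul w),
      integral_add (hA.const_mul β) (hB.const_mul (j : ℂ)), integral_const_mul,
      integral_const_mul, integral_const_mul] at hftc
    have h1 : powLog β j 1 = 0 ^ j := by simp [powLog]
    simp only [h1, Complex.ofReal_one, one_mul, Complex.ofReal_zero, zero_mul, sub_zero] at hftc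
    unfold stieltjes
    linear_combination -hftc
  · have ht0 := hne t ht.1.le
    have hd := (hasDerivAt_mul_powLog β j ht.1).mul
      (((hasDerivAt_id (t : ℂ)).add_const w).inv ht0).comp_ofReal
    refine hd.congr_deriv ?_
    simp only [id, Pi.inv_apply]
    field_simp
    ring

/-! ### Solving the Euler equation: power series, and `w ^ β` times polynomials in `log w`. -/

theorem exists_derivative_eq (R : Polynomial ℂ) : ∃ Q : Polynomial ℂ, Q.derivative = R := by
  induction R using Polynomial.induction_on' with
  | add p q hp hq =>
    obtain ⟨P, rfl⟩ := hp
    obtain ⟨Q, rfl⟩ := hq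
    exact ⟨P + Q, Polynomial.derivative_add⟩
  | monomial n a =>
    refine ⟨Polynomial.monomial (n + 1) (a / (n + 1)), ?_⟩
    rw [Polynomial.derivative_monomial, Nat.add_sub_cancel]
    have : (n : ℂ) + 1 ≠ 0 := by exact_mod_cast n.succ_ne_zero
    congr 1
    push_cast
    field_simp

/-- The coefficients of the power series solution of the iterated equation
`(w d/dw - β) ^ (j + 1) u = 1 / (1 + w)`, up to resonance. -/
noncomputable def frobeniusCoeff (β : ℂ) (j n : ℕ) : ℂ :=
  if (n : ℂ) = β then 0 else (-1) ^ n / ((n : ℂ) - β) ^ (j + 1)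

noncomputable def frobenius (β : ℂ) (j : ℕ) (w : ℂ) : ℂ := ∑' n, frobeniusCoeff β j n * w ^ n

theorem summable_frobeniusCoeff (β : ℂ) (j : ℕ) {r : ℝ} (h0 : 0 ≤ r) (h1 : r < 1) :
    Summable fun n => ‖frobeniusCoeff β j n‖ * r ^ n := by
  refine Summable.of_norm_bounded_eventually_nat (g := fun n => r ^ n)
    (summable_geometric_of_lt_one h0 h1) ?_
  filter_upwards [eventually_ge_atTop (Nat.ceil (‖β‖ + 1))] with n hn
  have hn' : ‖β‖ + 1 ≤ n := Nat.ceil_le.1 hn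
  have h2 : 1 ≤ ‖(n : ℂ) - β‖ := by
    have := norm_sub_norm_le (n : ℂ) β
    rw [Complex.norm_natCast] at this
    linarith
  rw [norm_mul, norm_norm, norm_pow, Real.norm_of_nonneg h0]
  refine mul_le_of_le_one_left (by positivity) ?_
  unfold frobeniusCoeff
  split_ifs
  · simp
  · rw [norm_div, norm_pow, norm_neg, norm_one, one_pow, norm_pow]
    exact div_le_one_of_le₀ (one_le_pow₀ h2) (by positivity)

theorem summable_frobenius (β : ℂ) (j : ℕ) {w : ℂ} (hw : ‖w‖ < 1) :
    Summable fun n => frobeniusCoeff β j n * w ^ n :=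
  .of_norm <| by simpa [norm_mul, norm_pow] using summable_frobeniusCoeff β j (norm_nonneg w) hw

theorem differentiableAt_frobenius (β : ℂ) (j : ℕ) {w : ℂ} (hw : ‖w‖ < 1) :
    DifferentiableAt ℂ (frobenius β j) w :=
  (differentiableAt_powerSeries (fun _ => summable_frobeniusCoeff β j) hw).1

theorem frobenius_euler (β : ℂ) (j : ℕ) {w : ℂ} (hw : ‖w‖ < 1) :
    w * deriv (frobenius β j) w - β * frobenius β j w =
      ∑' n : ℕ, ((n : ℂ) - β) * frobeniusCoeff β j n * w ^ n := by
  have hs := summable_frobenius β j hw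
  have h := (differentiableAt_powerSeries (fun _ => summable_frobeniusCoeff β j) hw).2
  change w * deriv (frobenius β j) w = _ at h
  have hn : Summable fun n : ℕ => (n : ℂ) * frobeniusCoeff β j n * w ^ n := by
    obtain ⟨r, hr1, hr2⟩ := exists_between hw
    have hr0 : 0 < r := (norm_nonneg w).trans_lt hr1
    have hu := summable_frobeniusCoeff β j ((norm_nonneg w).trans hr1.le) hr2
    have hq : ‖w‖ / r < 1 := by
      rwa [div_lt_one hr0]
    have hlim := (tendsto_self_mul_const_pow_of_lt_one (by positivity) hq)
    refine Summable.of_norm_bounded_eventually_nat (g := _) hu ?_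
    filter_upwards [hlim.eventually (gt_mem_nhds one_pos)] with n hn
    rw [norm_mul, norm_mul, norm_pow, Complex.norm_natCast]
    have : (n : ℝ) * ‖w‖ ^ n ≤ r ^ n := by
      rw [div_pow, mul_div_assoc', div_lt_one (by positivity)] at hn
      exact hn.le
    calc (n : ℝ) * ‖frobeniusCoeff β j n‖ * ‖w‖ ^ n
        = ‖frobeniusCoeff β j n‖ * (n * ‖w‖ ^ n) := by ring
      _ ≤ _ := by gcongr
  rw [h, frobenius, ← tsum_mul_left, ← hn.tsum_sub (hs.mul_left β)]
  exact tsum_congr fun n => by ring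

theorem frobenius_euler_succ (β : ℂ) (j : ℕ) {w : ℂ} (hw : ‖w‖ < 1) :
    w * deriv (frobenius β (j + 1)) w - β * frobenius β (j + 1) w = frobenius β j w := by
  rw [frobenius_euler β _ hw, frobenius]
  refine tsum_congr fun n => ?_
  congr 1
  unfold frobeniusCoeff
  split_ifs with h
  · simp
  · have : (n : ℂ) - β ≠ 0 := sub_ne_zero.2 h
    field_simp
    ring

/-- The operator `w d/dw - β` kills `w ^ m` when `β = m`, so that term of the geometric series
cannot be produced; it is the defect `c * w ^ β` with `c = (-1) ^ m`. Without resonance `c = 0`. -/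
theorem frobenius_euler_zero (β : ℂ) :
    ∃ c : ℂ, ∀ w : ℂ, ‖w‖ < 1 →
      w * deriv (frobenius β 0) w - β * frobenius β 0 w = (1 + w)⁻¹ - c * w ^ β := by
  have hterm : ∀ (w : ℂ) (n : ℕ), ((n : ℂ) - β) * frobeniusCoeff β 0 n * w ^ n =
      (-w) ^ n - if (n : ℂ) = β then (-w) ^ n else 0 := by
    intro w n
    unfold frobeniusCoeff
    split_ifs with h
    · simp
    · have : (n : ℂ) - β ≠ 0 := sub_ne_zero.2 h
      rw [neg_pow w]
      field_simp
      ring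
  have hgeom : ∀ w : ℂ, ‖w‖ < 1 → HasSum (fun n : ℕ => (-w) ^ n) (1 + w)⁻¹ := fun w hw => by
    simpa [sub_neg_eq_add] using hasSum_geometric_of_norm_lt_one (ξ := -w) (by simpa using hw)
  by_cases hβ : ∃ m : ℕ, (m : ℂ) = β
  · obtain ⟨m, rfl⟩ := hβ
    refine ⟨(-1) ^ m, fun w hw => ?_⟩
    rw [frobenius_euler _ _ hw, tsum_congr (hterm w)]
    have h2 : HasSum (fun n : ℕ => if (n : ℂ) = m then (-w) ^ n else 0) ((-w) ^ m) := by
      convert hasSum_ite_eq m ((-w) ^ m) using 2 with n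
      by_cases h : n = m
      · simp [h]
      · simp [h]
    rw [((hgeom w hw).sub h2).tsum_eq, Complex.cpow_natCast, neg_pow w]
  · refine ⟨0, fun w hw => ?_⟩
    rw [frobenius_euler _ _ hw, tsum_congr (hterm w)]
    have : ∀ n : ℕ, (n : ℂ) ≠ β := fun n h => hβ ⟨n, h⟩
    simp [this, (hgeom w hw).tsum_eq]

/-- With the integrating factor `w ^ (-β)` the equation reads `(w ^ (-β) v)' = R(log w) / w`. A
primitive of the right side is `Q(log w)` with `Q' = R`, and the slit disc is connected. -/
theorem exists_eq_cpow_mul_eval_log {β : ℂ} {v : ℂ → ℂ} (R : Polynomial ℂ)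
    (hv : ∀ w ∈ Complex.slitPlane ∩ ball 0 1, DifferentiableAt ℂ v w ∧
      w * deriv v w - β * v w = w ^ β * R.eval (Complex.log w)) :
    ∃ Q : Polynomial ℂ, ∀ w ∈ Complex.slitPlane ∩ ball 0 1,
      v w = w ^ β * Q.eval (Complex.log w) := by
  obtain ⟨Q, rfl⟩ := exists_derivative_eq R
  have hopen : IsOpen (Complex.slitPlane ∩ ball (0 : ℂ) 1) :=
    Complex.isOpen_slitPlane.inter isOpen_ball
  have hconn : IsPreconnected (Complex.slitPlane ∩ ball (0 : ℂ) 1) := by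
    -- Both the slit plane and the disc are star-shaped about `1 / 2`.
    have h1 : StarConvex ℝ (((1 / 2 : ℝ) : ℂ)) (ball (0 : ℂ) 1) :=
      (convex_ball _ _).starConvex (by simp; norm_num)
    exact ((Complex.starConvex_ofReal_slitPlane (by norm_num)).inter h1).isPathConnected
      ⟨Complex.ofReal_mem_slitPlane.2 (by norm_num), by simp; norm_num⟩
      |>.isConnected.isPreconnected
  have hder : ∀ w ∈ Complex.slitPlane ∩ ball (0 : ℂ) 1,
      HasDerivAt (fun w => w ^ (-β) * v w - Q.eval (Complex.log w)) 0 w := by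
    intro w hw
    have hw0 : w ≠ 0 := Complex.slitPlane_ne_zero hw.1
    have h1 := (hasDerivAt_id w).cpow_const (c := -β) hw.1
    have h2 := (Q.hasDerivAt (Complex.log w)).comp w (Complex.hasDerivAt_log hw.1)
    refine ((h1.mul (hv w hw).1.hasDerivAt).sub h2).congr_deriv ?_
    have h3 := (hv w hw).2
    have hc : w ^ (-β) * w ^ β = 1 := by
      rw [← Complex.cpow_add _ _ hw0]; simp
    simp only [id, mul_one]
    rw [Complex.cpow_sub _ _ hw0, Complex.cpow_one]
    field_simp
    linear_combination w ^ (-β) * h3 + (Q.derivative.eval (Complex.log w)) * hc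
  obtain ⟨C, hC⟩ := hopen.exists_is_const_of_deriv_eq_zero hconn
    (fun w hw => (hder w hw).differentiableAt.differentiableWithinAt) fun w hw => (hder w hw).deriv
  refine ⟨Q + Polynomial.C C, fun w hw => ?_⟩
  have hw0 : w ≠ 0 := Complex.slitPlane_ne_zero hw.1
  have hc : w ^ β * w ^ (-β) = 1 := by
    rw [← Complex.cpow_add _ _ hw0]; simp
  have := hC w hw
  simp only [Polynomial.eval_add, Polynomial.eval_C]
  linear_combination w ^ β * this - v w * hc

/-- The weight `j!` makes the inhomogeneities cancel: the left sides `u_j` satisfy `(w d/dw - β)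
u_{j+1} = (j + 1) u_j` and `(w d/dw - β) u_0 = -c w ^ β`. -/
theorem stieltjes_eq {β : ℂ} (hβ : 0 < β.re) (j : ℕ) :
    ∃ Q : Polynomial ℂ, ∀ w ∈ Complex.slitPlane ∩ ball 0 1,
      stieltjes β j w + j.factorial * frobenius β j w = w ^ β * Q.eval (Complex.log w) := by
  induction j with
  | zero =>
    obtain ⟨c, hc⟩ := frobenius_euler_zero β
    refine exists_eq_cpow_mul_eval_log (-Polynomial.C c) fun w hw => ?_
    have hw1 : ‖w‖ < 1 := mem_ball_zero_iff.1 hw.2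
    obtain ⟨d, hd, he⟩ := stieltjes_euler hβ 0 hw.1
    have hf := (differentiableAt_frobenius β 0 hw1).hasDerivAt
    have := hd.add (hf.const_mul ((Nat.factorial 0 : ℕ) : ℂ))
    refine ⟨this.differentiableAt, ?_⟩
    have hd' : deriv (fun w => stieltjes β 0 w + (Nat.factorial 0 : ℕ) * frobenius β 0 w) w = _ :=
      this.deriv
    rw [hd']
    simp at he ⊢
    linear_combination he + hc w hw1
  | succ j ih =>
    obtain ⟨Q, hQ⟩ := ih
    refine exists_eq_cpow_mul_eval_log (((j + 1 : ℕ) : ℂ) • Q) fun w hw => ?_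
    have hw1 : ‖w‖ < 1 := mem_ball_zero_iff.1 hw.2
    obtain ⟨d, hd, he⟩ := stieltjes_euler hβ (j + 1) hw.1
    have hf := (differentiableAt_frobenius β (j + 1) hw1).hasDerivAt
    have := hd.add (hf.const_mul ((Nat.factorial (j + 1) : ℕ) : ℂ))
    refine ⟨this.differentiableAt, ?_⟩
    have hd' : deriv (fun w => stieltjes β (j + 1) w +
        (Nat.factorial (j + 1) : ℕ) * frobenius β (j + 1) w) w = _ := this.deriv
    rw [hd']
    have hq := hQ w hw
    have hz : (0 : ℂ) ^ (j + 1) = 0 := by simp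
    rw [Nat.add_sub_cancel, hz] at he
    rw [Polynomial.eval_smul, smul_eq_mul]
    have hfac : ((Nat.factorial (j + 1) : ℕ) : ℂ) = ((j + 1 : ℕ) : ℂ) * (Nat.factorial j : ℕ) := by
      rw [Nat.factorial_succ]; push_cast; ring
    rw [hfac]
    linear_combination he + ((j + 1 : ℕ) : ℂ) * hq +
      ((j + 1 : ℕ) : ℂ) * (Nat.factorial j : ℕ) * frobenius_euler_succ β j hw1

/-! ### The Bose integral on the cut plane. -/

/-- The plane cut along `[1, ∞)`. -/
def cutPlane : Set ℂ := {z | 1 - z ∈ Complex.slitPlane}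

theorem isOpen_cutPlane : IsOpen cutPlane :=
  Complex.isOpen_slitPlane.preimage (by fun_prop)

theorem mem_cutPlane_of_norm_lt_one {z : ℂ} (hz : ‖z‖ < 1) : z ∈ cutPlane := by
  refine Or.inl ?_
  have := Complex.re_le_norm z
  simp only [Complex.sub_re, Complex.one_re]
  linarith

theorem one_sub_mul_ne_zero_of_mem_cutPlane {z : ℂ} (hz : z ∈ cutPlane) {s : ℝ} (h0 : 0 ≤ s)
    (h1 : s ≤ 1) : 1 - z * s ≠ 0 := by
  intro h
  rcases h0.eq_or_lt with rfl | h0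
  · simp at h
  have hs : (s : ℂ) ≠ 0 := by exact_mod_cast h0.ne'
  have hz' : 1 - z = ((1 - s⁻¹ : ℝ) : ℂ) := by
    push_cast
    field_simp
    linear_combination h
  have hz : 1 - z ∈ Complex.slitPlane := hz
  rw [hz', Complex.ofReal_mem_slitPlane] at hz
  linarith [(one_le_inv₀ h0).2 h1]

/-- `∑ zⁿ⁺¹ ∫ t ^ β (log t) ^ j e ^ (-(n + 1) t) dt`, summed under the integral sign. -/
noncomputable def boseIntegral (β : ℂ) (j : ℕ) (z : ℂ) : ℂ :=
  ∫ t in Ioi (0 : ℝ), powLog β j t * (Real.exp (-t) : ℂ) * (z / (1 - z * (Real.exp (-t) : ℝ)))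

theorem integrableOn_powLog_mul_exp_neg {β : ℂ} (hβ : 0 < β.re) (j : ℕ) :
    IntegrableOn (fun t => powLog β j t * (Real.exp (-t) : ℂ)) (Ioi 0) := by
  simpa using integrableOn_powLog_mul_exp hβ j one_pos

theorem differentiableOn_boseIntegral {β : ℂ} (hβ : 0 < β.re) (j : ℕ) :
    DifferentiableOn ℂ (boseIntegral β j) cutPlane := by
  intro z₀ hz₀
  obtain ⟨c, hc, hcb⟩ := exists_pos_le_norm_of_isCompact (isCompact_Icc (α := ℝ) (a := 0) (b := 1))
    (f := fun s : ℝ => 1 - z₀ * (s : ℂ)) (by fun_prop)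
    fun s hs => one_sub_mul_ne_zero_of_mem_cutPlane hz₀ hs.1 hs.2
  have hb : ∀ t : ℝ, 0 < t → ∀ z ∈ ball z₀ (c / 2), c / 2 ≤ ‖1 - z * (Real.exp (-t) : ℝ)‖ := by
    intro t ht z hz
    have he : Real.exp (-t) ≤ 1 := Real.exp_le_one_iff.2 (by linarith)
    have h1 := hcb (Real.exp (-t)) ⟨(Real.exp_pos _).le, he⟩
    rw [mem_ball, dist_eq_norm] at hz
    have h2 : ‖1 - z₀ * (Real.exp (-t) : ℝ)‖ ≤
        ‖1 - z * (Real.exp (-t) : ℝ)‖ + ‖(z - z₀) * (Real.exp (-t) : ℝ)‖ := by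
      rw [show 1 - z₀ * ((Real.exp (-t) : ℝ) : ℂ) = (1 - z * (Real.exp (-t) : ℝ)) +
        (z - z₀) * (Real.exp (-t) : ℝ) by ring]
      exact norm_add_le _ _
    have h3 : ‖(z - z₀) * (Real.exp (-t) : ℝ)‖ ≤ ‖z - z₀‖ := by
      rw [norm_mul, Complex.norm_real, Real.norm_eq_abs, Real.abs_exp]
      exact mul_le_of_le_one_right (norm_nonneg _) he
    linarith
  have hne : ∀ t : ℝ, 0 < t → ∀ z ∈ ball z₀ (c / 2), 1 - z * (Real.exp (-t) : ℝ) ≠ 0 :=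
    fun t ht z hz => norm_pos_iff.1 (by linarith [hb t ht z hz])
  refine ((hasDerivAt_integral_kernel (integrableOn_powLog_mul_exp_neg hβ j)
    (K := fun z t => z / (1 - z * (Real.exp (-t) : ℝ)))
    (ε := c / 2) (C := (‖z₀‖ + c / 2) / (c / 2)) (by positivity) ?_ ?_ ?_).2).differentiableAt
      |>.differentiableWithinAt
  · intro z hz
    exact (by fun_prop : Measurable fun t : ℝ =>
      z / (1 - z * (Real.exp (-t) : ℝ))).aestronglyMeasurable
  · refine (ae_restrict_iff' measurableSet_Ioi).2 (Eventually.of_forall fun t ht z hz => ?_)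
    exact DifferentiableAt.differentiableWithinAt
      (DifferentiableAt.fun_div (by fun_prop) (by fun_prop) (hne t ht z hz))
  · refine (ae_restrict_iff' measurableSet_Ioi).2 (Eventually.of_forall fun t ht z hz => ?_)
    rw [norm_div]
    have h1 : ‖z‖ ≤ ‖z₀‖ + c / 2 := by
      rw [mem_ball, dist_eq_norm] at hz
      linarith [norm_le_insert' z z₀]
    exact div_le_div₀ (by positivity) h1 (by positivity) (hb t ht z hz)

/-! ### Moments, Taylor coefficients, and the triangular relation with polylogarithms. -/

/-- The moments `∫ t ^ β (log t) ^ j e ^ (-t) dt`, that is, the derivatives of `Γ` at `β + 1`. -/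
noncomputable def gammaMoment (β : ℂ) (j : ℕ) : ℂ :=
  ∫ t in Ioi (0 : ℝ), powLog β j t * (Real.exp (-t) : ℂ)

theorem gammaMoment_zero_ne_zero {β : ℂ} (hβ : 0 < β.re) : gammaMoment β 0 ≠ 0 := by
  have h : gammaMoment β 0 = Complex.Gamma (β + 1) := by
    rw [Complex.Gamma_eq_integral (by simp; linarith), Complex.GammaIntegral, gammaMoment]
    refine setIntegral_congr_fun measurableSet_Ioi fun t ht => ?_
    simp [powLog, mul_comm]
  rw [h]
  exact Complex.Gamma_ne_zero_of_re_pos (by simp; linarith)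

/-- Binomial expansion of `log t = log (c t) - log c`, in preparation for the substitution `s = c
t`. -/
theorem powLog_eq_of_mul {β : ℂ} (j : ℕ) {c t : ℝ} (hc : 0 < c) (ht : 0 < t) :
    powLog β j t = (c : ℂ) ^ (-β) * ∑ i ∈ Finset.range (j + 1),
      ((j.choose i : ℂ) * (-1) ^ i * (Real.log c : ℂ) ^ i) * powLog β (j - i) (c * t) := by
  have hlog : (Real.log t : ℂ) = -(Real.log c : ℂ) + (Real.log (c * t) : ℂ) := by
    rw [Real.log_mul hc.ne' ht.ne']; push_cast; ring
  have hcpow : ((c * t : ℝ) : ℂ) ^ β = (c : ℂ) ^ β * (t : ℂ) ^ β := by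
    rw [Complex.ofReal_mul, Complex.mul_cpow_ofReal_nonneg hc.le ht.le]
  have hc0 : (c : ℂ) ^ (-β) * (c : ℂ) ^ β = 1 := by
    rw [← Complex.cpow_add _ _ (by exact_mod_cast hc.ne')]; simp
  rw [powLog, hlog, add_pow, Finset.mul_sum, Finset.mul_sum]
  refine Finset.sum_congr rfl fun i _ => ?_
  rw [powLog, hcpow, neg_pow (Real.log c : ℂ)]
  linear_combination -(t : ℂ) ^ β * (j.choose i : ℂ) * (-1) ^ i * (Real.log c : ℂ) ^ i *
    (Real.log (c * t) : ℂ) ^ (j - i) * hc0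

theorem integral_powLog_mul_exp {β : ℂ} (hβ : 0 < β.re) (j : ℕ) {c : ℝ} (hc : 0 < c) :
    ∫ t in Ioi (0 : ℝ), powLog β j t * (Real.exp (-(c * t)) : ℂ) =
      (c : ℂ) ^ (-(β + 1)) * ∑ i ∈ Finset.range (j + 1),
        ((j.choose i : ℂ) * (-1) ^ i * (Real.log c : ℂ) ^ i) * gammaMoment β (j - i) := by
  set g : ℝ → ℂ := fun s => (c : ℂ) ^ (-β) * ∑ i ∈ Finset.range (j + 1),
      ((j.choose i : ℂ) * (-1) ^ i * (Real.log c : ℂ) ^ i) *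
        (powLog β (j - i) s * (Real.exp (-s) : ℂ)) with hg
  have h1 : ∫ t in Ioi (0 : ℝ), powLog β j t * (Real.exp (-(c * t)) : ℂ) =
      ∫ t in Ioi (0 : ℝ), g (c * t) := by
    refine setIntegral_congr_fun measurableSet_Ioi fun t ht => ?_
    simp only [hg]
    rw [powLog_eq_of_mul j hc ht, mul_assoc, Finset.sum_mul]
    simp only [mul_assoc]
  rw [h1, integral_comp_mul_left_Ioi g 0 hc, mul_zero, hg, integral_const_mul,
    integral_finsetSum _ fun i _ => (integrableOn_powLog_mul_exp_neg hβ _).const_mul _]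
  simp only [integral_const_mul]
  have hc' : (c : ℂ) ≠ 0 := by exact_mod_cast hc.ne'
  rw [show -(β + 1) = -β - 1 by ring, Complex.cpow_sub _ _ hc', Complex.cpow_one,
    Complex.real_smul]
  simp only [gammaMoment]
  push_cast
  ring

/-- The Taylor coefficients `(log n) ^ k n ^ (-α)` of the polylogarithm. -/
noncomputable def polylogCoeff (α : ℂ) (k n : ℕ) : ℂ :=
  if n = 0 then 0 else (Real.log n : ℂ) ^ k * (n : ℂ) ^ (-α)

theorem polylogTerm_eq (α : ℂ) (k : ℕ) (z : ℂ) (n : ℕ) :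
    polylogTerm α k z n = polylogCoeff α k (n + 1) * z ^ (n + 1) := by
  simp [polylogTerm, polylogCoeff]

theorem summable_polylogCoeff (α : ℂ) (k : ℕ) {r : ℝ} (h0 : 0 ≤ r) (h1 : r < 1) :
    Summable fun n => ‖polylogCoeff α k n‖ * r ^ n := by
  have hM := summable_pow_mul_geometric_of_norm_lt_one (k + Nat.ceil |α.re|) (r := r)
    (by rwa [Real.norm_of_nonneg h0])
  refine Summable.of_nonneg_of_le (fun n => by positivity) (fun n => ?_) hM
  refine mul_le_mul_of_nonneg_right ?_ (by positivity)
  unfold polylogCoeff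
  split_ifs with hn
  · simp only [norm_zero]; positivity
  · have hn1 : (1 : ℝ) ≤ n := by exact_mod_cast Nat.one_le_iff_ne_zero.2 hn
    rw [norm_mul, norm_pow, Complex.norm_real, Real.norm_of_nonneg (Real.log_nonneg hn1),
      Complex.norm_natCast_cpow_of_pos (Nat.pos_of_ne_zero hn), pow_add]
    refine mul_le_mul (pow_le_pow_left₀ (Real.log_nonneg hn1) ?_ k) ?_ (by positivity)
      (by positivity)
    · linarith [Real.log_le_sub_one_of_pos (show (0 : ℝ) < n by linarith)]
    · rw [← Real.rpow_natCast]
      refine Real.rpow_le_rpow_of_exponent_le hn1 ?_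
      exact (neg_le_abs α.re).trans (Nat.le_ceil _)

theorem summable_polylogCoeff_mul_pow (α : ℂ) (k : ℕ) {z : ℂ} (hz : ‖z‖ < 1) :
    Summable fun n => polylogCoeff α k n * z ^ n :=
  .of_norm <| by simpa [norm_mul, norm_pow] using summable_polylogCoeff α k (norm_nonneg z) hz

theorem summable_polylogTerm (α : ℂ) (k : ℕ) {z : ℂ} (hz : ‖z‖ < 1) :
    Summable (polylogTerm α k z) := by
  simp only [funext (polylogTerm_eq α k z)]
  exact (summable_nat_add_iff 1).2 (summable_polylogCoeff_mul_pow α k hz)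

theorem polylog_eq_tsum (α : ℂ) (k : ℕ) {z : ℂ} (hz : ‖z‖ < 1) :
    polylog α k z = ∑' n, polylogCoeff α k n * z ^ n := by
  rw [(summable_polylogCoeff_mul_pow α k hz).tsum_eq_zero_add, polylog,
    tsum_congr (polylogTerm_eq α k z)]
  simp [polylogCoeff]

theorem polylog_euler (α : ℂ) (k : ℕ) {z : ℂ} (hz : ‖z‖ < 1) :
    z * deriv (polylog α k) z = polylog (α - 1) k z := by
  have h := (differentiableAt_powerSeries (fun _ => summable_polylogCoeff α k) hz).2
  have he : polylog α k =ᶠ[𝓝 z] fun z => ∑' n, polylogCoeff α k n * z ^ n := by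
    filter_upwards [isOpen_ball.mem_nhds (mem_ball_zero_iff.2 hz)] with w hw
    exact polylog_eq_tsum α k (mem_ball_zero_iff.1 hw)
  rw [he.deriv_eq, h, polylog_eq_tsum _ _ hz]
  refine tsum_congr fun n => ?_
  congr 1
  unfold polylogCoeff
  split_ifs with hn
  · simp
  · have hn' : (n : ℂ) ≠ 0 := by exact_mod_cast hn
    rw [show -(α - 1) = -α + 1 by ring, Complex.cpow_add _ _ hn', Complex.cpow_one]
    ring

/-- Expand the kernel as a geometric series in `z e ^ (-t)` and integrate termwise; the `L¹` norms
of the terms are at most a constant times `‖z‖ ^ (n + 1)`. -/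
theorem boseIntegral_eq_sum {β : ℂ} (hβ : 0 < β.re) (j : ℕ) {z : ℂ} (hz : ‖z‖ < 1) :
    boseIntegral β j z = ∑ i ∈ Finset.range (j + 1),
      ((j.choose i : ℂ) * (-1) ^ i * gammaMoment β (j - i)) * polylog (β + 1) i z := by
  set F : ℕ → ℝ → ℂ := fun n t =>
    z ^ (n + 1) * (powLog β j t * (Real.exp (-(((n + 1 : ℕ) : ℝ) * t)) : ℂ)) with hF
  have hint : ∀ n, IntegrableOn (F n) (Ioi 0) := fun n =>
    (integrableOn_powLog_mul_exp hβ j (by positivity)).const_mul _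
  have hsum : Summable fun n => ∫ t in Ioi (0 : ℝ), ‖F n t‖ := by
    refine Summable.of_nonneg_of_le (fun n => integral_nonneg fun t => norm_nonneg _)
      (f := fun n => ‖z‖ ^ (n + 1) *
        ∫ t in Ioi (0 : ℝ), ‖powLog β j t * (Real.exp (-t) : ℂ)‖) (fun n => ?_) ?_
    · rw [← integral_const_mul]
      refine setIntegral_mono_on (hint n).norm
        ((integrableOn_powLog_mul_exp_neg hβ j).norm.const_mul _) measurableSet_Ioi fun t ht => ?_
      have ht : 0 < t := ht
      simp only [hF, norm_mul, norm_pow, Complex.norm_real, Real.norm_eq_abs, Real.abs_exp]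
      gcongr
      push_cast
      nlinarith [n.cast_nonneg (α := ℝ)]
    · exact ((summable_nat_add_iff 1).2
        (summable_geometric_of_lt_one (norm_nonneg z) hz)).mul_right _
  have key := (hasSum_integral_of_summable_integral_norm hint hsum)
  have hbose : ∫ t in Ioi (0 : ℝ), ∑' n, F n t = boseIntegral β j z := by
    refine setIntegral_congr_fun measurableSet_Ioi fun t ht => ?_
    have ht : 0 < t := ht
    have he : Real.exp (-t) ≤ 1 := Real.exp_le_one_iff.2 (by linarith)
    have hlt : ‖z * (Real.exp (-t) : ℝ)‖ < 1 := by
      rw [norm_mul, Complex.norm_real, Real.norm_eq_abs, Real.abs_exp]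
      exact (mul_le_of_le_one_right (norm_nonneg _) he).trans_lt hz
    have hgeo := (hasSum_geometric_of_norm_lt_one hlt).mul_left
      (powLog β j t * (Real.exp (-t) : ℂ) * z)
    rw [div_eq_mul_inv, ← mul_assoc, ← hgeo.tsum_eq]
    refine tsum_congr fun n => ?_
    have : Real.exp (-(((n + 1 : ℕ) : ℝ) * t)) = Real.exp (-t) ^ (n + 1) := by
      rw [← Real.exp_nat_mul]; congr 1; ring
    simp only [hF, this]
    push_cast
    ring
  rw [hbose] at key
  refine key.unique ?_
  have hR : ∀ i ∈ Finset.range (j + 1), HasSum (fun n => ((j.choose i : ℂ) * (-1) ^ i *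
      gammaMoment β (j - i)) * polylogTerm (β + 1) i z n) (((j.choose i : ℂ) * (-1) ^ i *
      gammaMoment β (j - i)) * polylog (β + 1) i z) := fun i _ =>
    (summable_polylogTerm _ _ hz).hasSum.mul_left _
  refine (hasSum_sum hR).congr_fun fun n => ?_
  simp only [hF]
  rw [integral_const_mul, integral_powLog_mul_exp hβ j (by positivity), Finset.mul_sum,
    Finset.mul_sum]
  refine Finset.sum_congr rfl fun i _ => ?_
  simp only [polylogTerm]
  push_cast
  ring

/-! ### The Bose integral near `z = 1`. -/

/-- The regular part `1 / (eˢ - 1) - 1 / s` at the origin. -/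
noncomputable def boseRegular : ℂ → ℂ := dslope (fun s => (dslope Complex.exp 0 s)⁻¹) 0

/-- The zeros of `(e ^ s - 1) / s` are the nonzero multiples of `2πi`. -/
theorem dslope_exp_ne_zero {s : ℂ} (hs : ‖s‖ < 2 * Real.pi) : dslope Complex.exp 0 s ≠ 0 := by
  by_cases h0 : s = 0
  · simp [h0, dslope_same]
  · rw [dslope_of_ne _ h0, slope_def_field]
    refine div_ne_zero ?_ (by simpa using h0)
    rw [Complex.exp_zero, sub_ne_zero]
    intro h
    obtain ⟨n, rfl⟩ := Complex.exp_eq_one_iff.1 h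
    have hn : n ≠ 0 := by rintro rfl; simp at h0
    have h1 : (1 : ℝ) ≤ |(n : ℝ)| := by exact_mod_cast Int.one_le_abs hn
    simp only [norm_mul, Complex.norm_intCast, Complex.norm_ofNat, Complex.norm_real,
      Complex.norm_I, Real.norm_eq_abs, abs_of_pos Real.pi_pos, mul_one] at hs
    nlinarith [Real.pi_pos]

theorem differentiableOn_boseRegular : DifferentiableOn ℂ boseRegular (ball 0 (2 * Real.pi)) := by
  have hn : ball (0 : ℂ) (2 * Real.pi) ∈ 𝓝 0 := ball_mem_nhds _ (by positivity)
  refine (Complex.differentiableOn_dslope hn).2 (DifferentiableOn.inv ?_ fun s hs =>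
    dslope_exp_ne_zero (mem_ball_zero_iff.1 hs))
  exact (Complex.differentiableOn_dslope hn).2 Complex.differentiable_exp.differentiableOn

theorem boseRegular_eq {s : ℂ} (h0 : s ≠ 0) :
    boseRegular s = (Complex.exp s - 1)⁻¹ - s⁻¹ := by
  rw [boseRegular, dslope_of_ne _ h0, slope_def_field, dslope_same, dslope_of_ne _ h0,
    slope_def_field]
  simp
  field_simp

theorem analyticAt_integral_boseRegular {β : ℂ} (hβ : 0 < β.re) (j : ℕ) :
    AnalyticAt ℂ (fun w => ∫ t in Ioc (0 : ℝ) 1, powLog β j t * boseRegular (t + w)) 0 := by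
  have hpi := Real.pi_gt_three
  have hsub : closedBall (0 : ℂ) (3 / 2) ⊆ ball 0 (2 * Real.pi) :=
    closedBall_subset_ball (by linarith)
  obtain ⟨C, hC⟩ := (isCompact_closedBall (0 : ℂ) (3 / 2)).exists_bound_of_continuousOn
    (differentiableOn_boseRegular.continuousOn.mono hsub)
  -- The radius is `3 / 2 = 1 + 1 / 4 + 1 / 4`, well inside `2π`.
  have hmem : ∀ w₀ ∈ ball (0 : ℂ) (1 / 4), ∀ t ∈ Ioc (0 : ℝ) 1, ∀ w ∈ ball w₀ (1 / 4),
      (t : ℂ) + w ∈ closedBall (0 : ℂ) (3 / 2) := by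
    intro w₀ hw₀ t ht w hw
    rw [mem_closedBall_zero_iff]
    rw [mem_ball_zero_iff] at hw₀
    rw [mem_ball, dist_eq_norm] at hw
    have h1 : ‖(t : ℂ)‖ ≤ 1 := by
      rw [Complex.norm_real, Real.norm_eq_abs, abs_of_pos ht.1]; exact ht.2
    linarith [norm_add_le (t : ℂ) w, norm_le_insert' w w₀]
  refine DifferentiableOn.analyticAt (s := ball 0 (1 / 4)) (fun w₀ hw₀ => ?_)
    (ball_mem_nhds _ (by norm_num))
  refine ((hasDerivAt_integral_kernel (integrableOn_powLog hβ j)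
    (K := fun w t => boseRegular (t + w)) (ε := 1 / 4) (C := C) (by norm_num) ?_ ?_ ?_).2)
    |>.differentiableAt.differentiableWithinAt
  · intro w hw
    refine ContinuousOn.aestronglyMeasurable ?_ measurableSet_Ioc
    exact (differentiableOn_boseRegular.continuousOn.mono hsub).comp (by fun_prop)
      fun t ht => hmem w₀ hw₀ t ht w hw
  · refine (ae_restrict_iff' measurableSet_Ioc).2 (Eventually.of_forall fun t ht w hw => ?_)
    have := differentiableOn_boseRegular.differentiableAt
      (isOpen_ball.mem_nhds (hsub (hmem w₀ hw₀ t ht w hw)))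
    exact (this.comp w (differentiableAt_id.const_add (t : ℂ))).differentiableWithinAt
  · exact (ae_restrict_iff' measurableSet_Ioc).2 (Eventually.of_forall fun t ht w hw =>
      hC _ (hmem w₀ hw₀ t ht w hw))

/-- Keeps the tail kernel away from its poles, uniformly in `t > 1`. -/
theorem norm_exp_sub_exp_neg_ge {w : ℂ} (hw : ‖w‖ ≤ 1 / 2) {t : ℝ} (ht : 1 < t) :
    Real.exp (-(1 / 2)) - Real.exp (-1) ≤ ‖Complex.exp w - (Real.exp (-t) : ℝ)‖ := by
  have h1 : Real.exp (-(1 / 2)) ≤ ‖Complex.exp w‖ := by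
    rw [Complex.norm_exp]
    refine Real.exp_le_exp.2 ?_
    linarith [neg_le_of_abs_le (Complex.abs_re_le_norm w)]
  have h2 : ‖((Real.exp (-t) : ℝ) : ℂ)‖ ≤ Real.exp (-1) := by
    rw [Complex.norm_real, Real.norm_eq_abs, Real.abs_exp]
    exact Real.exp_le_exp.2 (by linarith)
  linarith [norm_sub_norm_le (Complex.exp w) ((Real.exp (-t) : ℝ) : ℂ)]

theorem analyticAt_integral_bose_tail {β : ℂ} (hβ : 0 < β.re) (j : ℕ) :
    AnalyticAt ℂ (fun w => ∫ t in Ioi (1 : ℝ), powLog β j t * (Real.exp (-t) : ℂ) *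
      (Complex.exp w - (Real.exp (-t) : ℝ))⁻¹) 0 := by
  have hδ : 0 < Real.exp (-(1 / 2)) - Real.exp (-1) :=
    sub_pos.2 (Real.exp_lt_exp.2 (by norm_num))
  have hmem : ∀ w₀ ∈ ball (0 : ℂ) (1 / 4), ∀ w ∈ ball w₀ (1 / 4), ‖w‖ ≤ 1 / 2 := by
    intro w₀ hw₀ w hw
    rw [mem_ball_zero_iff] at hw₀
    rw [mem_ball, dist_eq_norm] at hw
    linarith [norm_le_insert' w w₀]
  refine DifferentiableOn.analyticAt (s := ball 0 (1 / 4)) (fun w₀ hw₀ => ?_)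
    (ball_mem_nhds _ (by norm_num))
  refine ((hasDerivAt_integral_kernel
    ((integrableOn_powLog_mul_exp_neg hβ j).mono_set (Ioi_subset_Ioi zero_le_one))
    (K := fun w t => (Complex.exp w - (Real.exp (-t) : ℝ))⁻¹) (ε := 1 / 4)
    (C := (Real.exp (-(1 / 2)) - Real.exp (-1))⁻¹) (by norm_num) ?_ ?_ ?_).2)
    |>.differentiableAt.differentiableWithinAt
  · intro w hw
    exact (by fun_prop : Measurable fun t : ℝ =>
      (Complex.exp w - (Real.exp (-t) : ℝ))⁻¹).aestronglyMeasurable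
  · refine (ae_restrict_iff' measurableSet_Ioi).2 (Eventually.of_forall fun t ht w hw => ?_)
    refine DifferentiableAt.differentiableWithinAt ?_
    exact DifferentiableAt.inv (by fun_prop) (norm_pos_iff.1
      (hδ.trans_le (norm_exp_sub_exp_neg_ge (hmem w₀ hw₀ w hw) ht)))
  · refine (ae_restrict_iff' measurableSet_Ioi).2 (Eventually.of_forall fun t ht w hw => ?_)
    rw [norm_inv]
    exact inv_anti₀ hδ (norm_exp_sub_exp_neg_ge (hmem w₀ hw₀ w hw) ht)

/-- Near the origin of the slit plane `u` is an analytic function plus `w ^ β` times a polynomial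
in `log w`. -/
def HasLogSingularity (β : ℂ) (u : ℂ → ℂ) : Prop :=
  ∃ (H : ℂ → ℂ) (Q : Polynomial ℂ), AnalyticAt ℂ H 0 ∧
    ∀ᶠ w in 𝓝[Complex.slitPlane] 0, u w = H w + w ^ β * Q.eval (Complex.log w)

theorem HasLogSingularity.add {β : ℂ} {u v : ℂ → ℂ} (hu : HasLogSingularity β u)
    (hv : HasLogSingularity β v) : HasLogSingularity β (fun w => u w + v w) := by
  obtain ⟨H, Q, hH, h⟩ := hu
  obtain ⟨H', Q', hH', h'⟩ := hv
  refine ⟨fun w => H w + H' w, Q + Q', hH.add hH', ?_⟩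
  filter_upwards [h, h'] with w h1 h2
  rw [h1, h2, Polynomial.eval_add]; ring

theorem HasLogSingularity.const_mul {β : ℂ} {u : ℂ → ℂ} (hu : HasLogSingularity β u) (c : ℂ) :
    HasLogSingularity β (fun w => c * u w) := by
  obtain ⟨H, Q, hH, h⟩ := hu
  refine ⟨fun w => c * H w, c • Q, analyticAt_const.mul hH, ?_⟩
  filter_upwards [h] with w h1
  rw [h1, Polynomial.eval_smul, smul_eq_mul]; ring

/-- Split at `t = 1`. The regular part on `(0, 1]` and the tail are analytic in `w`; the polar part
`1 / (t + w)` gives `stieltjes β j`. -/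
theorem hasLogSingularity_boseIntegral {β : ℂ} (hβ : 0 < β.re) (j : ℕ) :
    HasLogSingularity β (fun w => boseIntegral β j (Complex.exp (-w))) := by
  obtain ⟨Q, hQ⟩ := stieltjes_eq hβ j
  have hfro : AnalyticAt ℂ (frobenius β j) 0 :=
    DifferentiableOn.analyticAt (s := ball 0 1) (fun w hw =>
      (differentiableAt_frobenius β j (mem_ball_zero_iff.1 hw)).differentiableWithinAt)
      (ball_mem_nhds _ one_pos)
  refine ⟨_, Q, ((analyticAt_integral_boseRegular hβ j).add
    (analyticAt_integral_bose_tail hβ j)).sub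
      ((analyticAt_const (v := (j.factorial : ℂ))).mul hfro), ?_⟩
  filter_upwards [self_mem_nhdsWithin, nhdsWithin_le_nhds (ball_mem_nhds (0 : ℂ)
    (show (0 : ℝ) < 1 / 2 by norm_num))] with w hw hwb
  have hwn : ‖w‖ < 1 / 2 := mem_ball_zero_iff.1 hwb
  have hq := hQ w ⟨hw, mem_ball_zero_iff.2 (by linarith)⟩
  have hne : ∀ t : ℝ, 0 ≤ t → (t : ℂ) + w ≠ 0 := fun t ht => add_ne_zero_of_mem_slitPlane hw ht
  have hmem : ∀ t ∈ Icc (0 : ℝ) 1, (t : ℂ) + w ∈ ball (0 : ℂ) (2 * Real.pi) := by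
    intro t ht
    have h1 : ‖(t : ℂ)‖ ≤ 1 := by
      rw [Complex.norm_real, Real.norm_eq_abs, abs_of_nonneg ht.1]; exact ht.2
    rw [mem_ball_zero_iff]
    linarith [norm_add_le (t : ℂ) w, Real.pi_gt_three]
  have hp : ContinuousOn (powLog β j) (Icc 0 1) :=
    (continuousOn_powLog hβ j).mono Icc_subset_Ici_self
  have hA : IntegrableOn (fun t : ℝ => powLog β j t * ((t : ℂ) + w)⁻¹) (Ioc 0 1) :=
    (hp.mul (ContinuousOn.inv₀ (by fun_prop) fun t ht => hne t ht.1)).integrableOn_Icc.mono_set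
      Ioc_subset_Icc_self
  have hB : IntegrableOn (fun t : ℝ => powLog β j t * boseRegular (t + w)) (Ioc 0 1) :=
    (hp.mul (differentiableOn_boseRegular.continuousOn.comp (by fun_prop)
      hmem)).integrableOn_Icc.mono_set Ioc_subset_Icc_self
  have hδ : 0 < Real.exp (-(1 / 2)) - Real.exp (-1) :=
    sub_pos.2 (Real.exp_lt_exp.2 (by norm_num))
  have hC : IntegrableOn (fun t : ℝ => powLog β j t * (Real.exp (-t) : ℂ) *
      (Complex.exp w - (Real.exp (-t) : ℝ))⁻¹) (Ioi 1) := by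
    refine Integrable.mul_bdd (c := (Real.exp (-(1 / 2)) - Real.exp (-1))⁻¹)
      ((integrableOn_powLog_mul_exp_neg hβ j).mono_set (Ioi_subset_Ioi zero_le_one))
      (by fun_prop : Measurable fun t : ℝ =>
        (Complex.exp w - (Real.exp (-t) : ℝ))⁻¹).aestronglyMeasurable ?_
    refine (ae_restrict_iff' measurableSet_Ioi).2 (Eventually.of_forall fun t ht => ?_)
    rw [norm_inv]
    exact inv_anti₀ hδ (norm_exp_sub_exp_neg_ge hwn.le ht)
  have hker : ∀ t : ℝ, Complex.exp (-w) / (1 - Complex.exp (-w) * (Real.exp (-t) : ℝ)) =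
      (Complex.exp w - (Real.exp (-t) : ℝ))⁻¹ := by
    intro t
    have h1 : Complex.exp w * Complex.exp (-w) = 1 := by rw [← Complex.exp_add]; simp
    have h2 : 1 - Complex.exp (-w) * (Real.exp (-t) : ℝ) =
        Complex.exp (-w) * (Complex.exp w - (Real.exp (-t) : ℝ)) := by
      linear_combination -h1
    rw [h2, div_mul_eq_div_div, div_self (Complex.exp_ne_zero _), one_div]
  have hker' : ∀ t ∈ Ioc (0 : ℝ) 1, powLog β j t * (Real.exp (-t) : ℂ) *
      (Complex.exp w - (Real.exp (-t) : ℝ))⁻¹ =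
      powLog β j t * ((t : ℂ) + w)⁻¹ + powLog β j t * boseRegular (t + w) := by
    intro t ht
    rw [boseRegular_eq (hne t ht.1.le), mul_assoc, ← mul_add, add_sub_cancel, Complex.exp_add]
    congr 1
    have h1 : (Real.exp (-t) : ℂ) = (Complex.exp t)⁻¹ := by push_cast; exact Complex.exp_neg _
    have h2 := Complex.exp_ne_zero (t : ℂ)
    rw [h1, ← mul_inv]
    congr 1
    field_simp
  simp only [boseIntegral, hker]
  have hAB : IntegrableOn (fun t : ℝ => powLog β j t * (Real.exp (-t) : ℂ) *
      (Complex.exp w - (Real.exp (-t) : ℝ))⁻¹) (Ioc 0 1) :=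
    (integrableOn_congr_fun hker' measurableSet_Ioc).2 (hA.add hB)
  rw [← Ioc_union_Ioi_eq_Ioi (zero_le_one' ℝ),
    setIntegral_union (Ioc_disjoint_Ioi le_rfl) measurableSet_Ioi hAB hC,
    setIntegral_congr_fun measurableSet_Ioc hker', integral_add hA hB]
  simp only [Pi.add_apply, Pi.sub_apply, Pi.mul_apply]
  unfold stieltjes at hq
  linear_combination hq

theorem HasLogSingularity.sum {β : ℂ} {ι : Type*} (s : Finset ι) {u : ι → ℂ → ℂ}
    (hu : ∀ i ∈ s, HasLogSingularity β (u i)) :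
    HasLogSingularity β (fun w => ∑ i ∈ s, u i w) := by
  classical
  induction s using Finset.induction_on with
  | empty => exact ⟨0, 0, analyticAt_const, by simp⟩
  | insert a s ha ih =>
    simp only [Finset.sum_insert ha]
    exact (hu a (Finset.mem_insert_self _ _)).add
      (ih fun i hi => hu i (Finset.mem_insert_of_mem hi))

/-! ### Continuation of the polylogarithm for all `α`. -/

/-- The polylogarithm continues to the cut plane, with a logarithmic singularity at `1` in the
coordinate `w = -log z`. -/
def HasPolylogContinuation (α : ℂ) (k : ℕ) : Prop :=
  ∃ F : ℂ → ℂ, DifferentiableOn ℂ F cutPlane ∧ (∀ z : ℂ, ‖z‖ < 1 → F z = polylog α k z) ∧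
    HasLogSingularity (α - 1) (fun w => F (Complex.exp (-w)))

/-- Strong induction on `k`: subtract the lower terms of the triangular relation and divide by the
diagonal coefficient `(-1) ^ k Γ(α)`. -/
theorem hasPolylogContinuation_of_one_lt_re {α : ℂ} (hα : 1 < α.re) (k : ℕ) :
    HasPolylogContinuation α k := by
  have hβ : 0 < (α - 1).re := by simpa using hα
  induction k using Nat.strong_induction_on with
  | _ k ih =>
    choose! F hFd hFe hFs using ih
    set c : ℕ → ℂ := fun i => (k.choose i : ℂ) * (-1) ^ i * gammaMoment (α - 1) (k - i) with hc
    have hck : c k ≠ 0 := by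
      simp [hc, gammaMoment_zero_ne_zero hβ]
    refine ⟨fun z => (c k)⁻¹ * (boseIntegral (α - 1) k z +
      (-1) * ∑ i ∈ Finset.range k, c i * F i z), ?_, ?_, ?_⟩
    · refine ((differentiableOn_boseIntegral hβ k).fun_add (DifferentiableOn.const_mul
        (DifferentiableOn.fun_sum fun i hi => (hFd i (Finset.mem_range.1 hi)).const_mul _)
        _)).const_mul _
    · intro z hz
      have hb : boseIntegral (α - 1) k z =
          ∑ i ∈ Finset.range k, c i * polylog α i z + c k * polylog α k z := by
        rw [boseIntegral_eq_sum hβ k hz, Finset.sum_range_succ, sub_add_cancel]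
      have : ∑ i ∈ Finset.range k, c i * F i z = ∑ i ∈ Finset.range k, c i * polylog α i z :=
        Finset.sum_congr rfl fun i hi => by rw [hFe i (Finset.mem_range.1 hi) z hz]
      simp only [hb, this]
      rw [neg_one_mul, add_neg_cancel_comm, inv_mul_cancel_left₀ hck]
    · exact ((hasLogSingularity_boseIntegral hβ k).add
        ((HasLogSingularity.sum (Finset.range k) fun i hi =>
          (hFs i (Finset.mem_range.1 hi)).const_mul (c i)).const_mul _)).const_mul _

theorem exp_neg_mem_cutPlane {w : ℂ} (hw : w ∈ Complex.slitPlane) (hn : ‖w‖ < Real.pi) :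
    Complex.exp (-w) ∈ cutPlane := by
  change 1 - Complex.exp (-w) ∈ Complex.slitPlane
  rw [Complex.mem_slitPlane_iff]
  by_cases him : w.im = 0
  · left
    have hre : 0 < w.re := (Complex.mem_slitPlane_iff.1 hw).resolve_right (by simp [him])
    simp [Complex.exp_re, him, hre]
  · right
    have h1 := abs_lt.1 ((Complex.abs_im_le_norm w).trans_lt hn)
    have hs : Real.sin w.im ≠ 0 := fun h =>
      him ((Real.sin_eq_zero_iff_of_lt_of_lt h1.1 h1.2).1 h)
    simp [Complex.exp_im, hs, Real.exp_ne_zero]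

/-- In the coordinate `w`, `z d/dz` is `-d/dw`, and `d/dw` turns `w ^ β Q(log w)` into `w ^ (β - 1)
(β Q + Q')(log w)`. -/
theorem HasPolylogContinuation.sub_one {α : ℂ} {k : ℕ} (h : HasPolylogContinuation α k) :
    HasPolylogContinuation (α - 1) k := by
  obtain ⟨F, hFd, hFe, H, Q, hH, hu⟩ := h
  refine ⟨fun z => z * deriv F z, differentiableOn_id.fun_mul (hFd.deriv isOpen_cutPlane),
    fun z hz => ?_, fun w => -deriv H w, -((α - 1) • Q + Q.derivative), hH.deriv.neg, ?_⟩
  · have he : F =ᶠ[𝓝 z] polylog α k := by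
      filter_upwards [isOpen_ball.mem_nhds (mem_ball_zero_iff.2 hz)] with w hw
      exact hFe w (mem_ball_zero_iff.1 hw)
    simp only [he.deriv_eq, polylog_euler α k hz]
  · filter_upwards [eventually_eventually_nhdsWithin.2 hu, self_mem_nhdsWithin,
      nhdsWithin_le_nhds hH.eventually_analyticAt,
      nhdsWithin_le_nhds (ball_mem_nhds (0 : ℂ) Real.pi_pos)] with w h1 hw h3 h4
    rw [Complex.isOpen_slitPlane.nhdsWithin_eq hw] at h1
    have hw0 := Complex.slitPlane_ne_zero hw
    have hd1 : HasDerivAt (fun w => F (Complex.exp (-w)))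
        (deriv F (Complex.exp (-w)) * (Complex.exp (-w) * (-1))) w :=
      ((hFd.differentiableAt (isOpen_cutPlane.mem_nhds
        (exp_neg_mem_cutPlane hw (mem_ball_zero_iff.1 h4)))).hasDerivAt).comp w
        (hasDerivAt_neg w).cexp
    have hd2 := (h3.differentiableAt.hasDerivAt).add
      (((hasDerivAt_id w).cpow_const (c := α - 1) hw).mul
        ((Q.hasDerivAt (Complex.log w)).comp w (Complex.hasDerivAt_log hw)))
    have := hd1.unique (hd2.congr_of_eventuallyEq h1)
    simp only [id, Function.comp_apply, mul_one] at this
    rw [Complex.cpow_sub _ _ hw0, Complex.cpow_one] at this ⊢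
    simp only [Polynomial.eval_neg, Polynomial.eval_add, Polynomial.eval_smul, smul_eq_mul]
    field_simp at this ⊢
    linear_combination -this

theorem hasPolylogContinuation (α : ℂ) (k : ℕ) : HasPolylogContinuation α k := by
  have key : ∀ (n : ℕ) (α : ℂ), 1 < α.re + n → HasPolylogContinuation α k := by
    intro n
    induction n with
    | zero => exact fun α h => hasPolylogContinuation_of_one_lt_re (by simpa using h) k
    | succ n ih =>
      intro α h
      have := (ih (α + 1) (by push_cast at h; simp; linarith)).sub_one
      rwa [add_sub_cancel_right] at this
  obtain ⟨n, hn⟩ := exists_nat_gt (1 - α.re)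
  exact key n α (by linarith)

/-! ### The `Δ`-domain and the comparison of scale elements. -/

section Domain

variable {ϑ r : ℝ}

theorem arg_one_sub_of_mem_deltaDomain (h0 : 0 < ϑ) {z : ℂ} (hz : z ∈ deltaDomain ϑ r) :
    |Complex.arg (1 - z)| < Real.pi - ϑ ∨ Complex.arg (1 - z) = 0 := by
  obtain ⟨-, hz1, ha⟩ := hz
  have hx : 1 - z = -(z - 1) := by ring
  have hpi := Complex.neg_pi_lt_arg (z - 1)
  have hpi' := Complex.arg_le_pi (z - 1)
  rcases lt_trichotomy (z - 1).im 0 with h | h | h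
  · left
    have hn : Complex.arg (z - 1) < 0 := Complex.arg_neg_iff.2 h
    rw [abs_of_neg hn] at ha
    rw [hx, Complex.arg_neg_eq_arg_add_pi_of_im_neg h, abs_lt]
    constructor <;> linarith
  · right
    have hre : (z - 1).re ≤ 0 := by
      by_contra! hre
      have : Complex.arg (z - 1) = 0 := Complex.arg_eq_zero_iff.2 ⟨hre.le, h⟩
      rw [this, abs_zero] at ha
      linarith
    rw [hx, Complex.arg_eq_zero_iff]
    exact ⟨by simpa using hre, by simpa using h⟩
  · left
    have hn : 0 ≤ Complex.arg (z - 1) := Complex.arg_nonneg_iff.2 h.le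
    rw [abs_of_nonneg hn] at ha
    rw [hx, Complex.arg_neg_eq_arg_sub_pi_of_im_pos h, abs_lt]
    constructor <;> linarith

theorem one_sub_mem_slitPlane_of_mem_deltaDomain (h0 : 0 < ϑ) {z : ℂ}
    (hz : z ∈ deltaDomain ϑ r) : 1 - z ∈ Complex.slitPlane := by
  rw [Complex.mem_slitPlane_iff_arg]
  refine ⟨fun h => ?_, sub_ne_zero.2 hz.2.1.symm⟩
  rcases arg_one_sub_of_mem_deltaDomain h0 hz with h' | h'
  · rw [h, abs_of_pos Real.pi_pos] at h'
    linarith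
  · exact Real.pi_ne_zero (h ▸ h')

theorem neBot_nhdsWithin_deltaDomain (hϑ : ϑ < Real.pi) (hr : 1 < r) :
    (𝓝[deltaDomain ϑ r] (1 : ℂ)).NeBot := by
  have ht : Tendsto (fun t : ℝ => 1 - (t : ℂ)) (𝓝[>] 0) (𝓝[deltaDomain ϑ r] 1) := by
    refine tendsto_nhdsWithin_iff.2 ⟨?_, ?_⟩
    · have : ContinuousAt (fun t : ℝ => 1 - (t : ℂ)) 0 := by fun_prop
      simpa using this.tendsto.mono_left nhdsWithin_le_nhds
    · filter_upwards [Ioo_mem_nhdsGT (zero_lt_one' ℝ)] with t ht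
      refine ⟨?_, ?_, ?_⟩
      · rw [show 1 - (t : ℂ) = ((1 - t : ℝ) : ℂ) by push_cast; ring, Complex.norm_real,
          Real.norm_eq_abs, abs_of_pos (by linarith [ht.2])]
        linarith [ht.1]
      · simpa using ht.1.ne'
      · rw [show 1 - (t : ℂ) - 1 = ((-t : ℝ) : ℂ) by push_cast; ring,
          Complex.arg_ofReal_of_neg (by linarith [ht.1]), abs_of_pos Real.pi_pos]
        exact hϑ
  exact NeBot.mono inferInstance ht

theorem tendsto_one_sub_deltaDomain :
    Tendsto (fun z : ℂ => 1 - z) (𝓝[deltaDomain ϑ r] 1) (𝓝[≠] 0) := by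
  refine tendsto_nhdsWithin_iff.2 ⟨?_, ?_⟩
  · have : ContinuousAt (fun z : ℂ => 1 - z) 1 := by fun_prop
    simpa using this.tendsto.mono_left nhdsWithin_le_nhds
  · filter_upwards [self_mem_nhdsWithin] with z hz
    exact sub_ne_zero.2 hz.2.1.symm

theorem tendsto_neg_log_norm_one_sub :
    Tendsto (fun z : ℂ => -Real.log ‖1 - z‖) (𝓝[deltaDomain ϑ r] 1) atTop := by
  have h := tendsto_norm_nhdsNE_zero.comp (tendsto_one_sub_deltaDomain (ϑ := ϑ) (r := r))
  exact tendsto_neg_atBot_atTop.comp (Real.tendsto_log_nhdsGT_zero.comp h)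

/-- The real part of `log (1 - z)⁻¹` tends to infinity while its imaginary part stays bounded. -/
theorem isTheta_log_factor (h0 : 0 < ϑ) :
    (fun z : ℂ => 1 / z * Complex.log (1 - z)⁻¹) =Θ[𝓝[deltaDomain ϑ r] 1]
      fun z => -Real.log ‖1 - z‖ := by
  have h1 : (fun z : ℂ => 1 / z) =Θ[𝓝[deltaDomain ϑ r] 1] fun _ => (1 : ℝ) := by
    have : Tendsto (fun z : ℂ => 1 / z) (𝓝[deltaDomain ϑ r] 1) (𝓝 1) := by
      have h : ContinuousAt (fun z : ℂ => 1 / z) 1 :=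
        continuousAt_const.div continuousAt_id one_ne_zero
      simpa using h.tendsto.mono_left nhdsWithin_le_nhds
    exact ⟨this.isBigO_one ℝ, (isBigO_const_left_iff_pos_le_norm one_ne_zero).2
      ⟨1 / 2, by norm_num, (this.norm.eventually_const_le (by norm_num))⟩⟩
  have h2 : (fun z : ℂ => Complex.log (1 - z)⁻¹) =Θ[𝓝[deltaDomain ϑ r] 1]
      fun z => -Real.log ‖1 - z‖ := by
    have ha : (fun z : ℂ => ((-Real.log ‖1 - z‖ : ℝ) : ℂ)) =Θ[𝓝[deltaDomain ϑ r] 1]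
        fun z => -Real.log ‖1 - z‖ :=
      IsTheta.of_norm_eventuallyEq_norm (Eventually.of_forall fun z => by
        simp only [Complex.norm_real])
    have hb : (fun z : ℂ => -((Complex.arg (1 - z) : ℂ) * Complex.I)) =o[𝓝[deltaDomain ϑ r] 1]
        fun z => -Real.log ‖1 - z‖ := by
      refine IsBigO.trans_isLittleO (g := fun _ => (1 : ℝ)) ?_
        ((isLittleO_const_left).2 (Or.inr ?_))
      · refine IsBigO.of_bound Real.pi (Eventually.of_forall fun z => ?_)
        simpa using Complex.abs_arg_le_pi (1 - z)
      · exact tendsto_norm_atTop_atTop.comp tendsto_neg_log_norm_one_sub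
    refine EventuallyEq.trans_isTheta ?_ (ha.add_isLittleO hb)
    filter_upwards [self_mem_nhdsWithin] with z hz
    rw [Complex.log_inv _ (Complex.slitPlane_arg_ne_pi
      (one_sub_mem_slitPlane_of_mem_deltaDomain h0 hz)), Complex.log]
    simp only [Pi.add_apply]
    push_cast
    ring
  simpa using h1.mul h2

/-- The size of a scale element in terms of `T = log (1 / |1 - z|)`. -/
noncomputable def scaleSize (p : ℂ × ℂ) (T : ℝ) : ℝ := Real.exp (p.1.re * T) * T ^ p.2.re

theorem isTheta_scale (h0 : 0 < ϑ) (p : ℂ × ℂ) :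
    scale p =Θ[𝓝[deltaDomain ϑ r] 1] fun z => scaleSize p (-Real.log ‖1 - z‖) := by
  have hx : ∀ᶠ z : ℂ in 𝓝[deltaDomain ϑ r] 1, 1 - z ≠ 0 := by
    filter_upwards [self_mem_nhdsWithin] with z hz using sub_ne_zero.2 hz.2.1.symm
  have hT := tendsto_neg_log_norm_one_sub (ϑ := ϑ) (r := r)
  have hL := isTheta_log_factor (r := r) h0
  have hL0 : ∀ᶠ z : ℂ in 𝓝[deltaDomain ϑ r] 1, 1 / z * Complex.log (1 - z)⁻¹ ≠ 0 := by
    filter_upwards [hL.eq_zero_iff, hT.eventually_gt_atTop 0] with z h1 h2 h3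
    exact h2.ne' (h1.1 h3)
  have h1 : (fun z : ℂ => (1 - z) ^ (-p.1)) =Θ[𝓝[deltaDomain ϑ r] 1]
      fun z => Real.exp (p.1.re * -Real.log ‖1 - z‖) := by
    refine (Complex.isTheta_cpow_const_rpow fun _ _ => hx).trans_eventuallyEq ?_
    filter_upwards [hx] with z hz
    rw [Real.rpow_def_of_pos (norm_pos_iff.2 hz), Complex.neg_re]
    congr 1; ring
  have h2 : (fun z : ℂ => (1 / z * Complex.log (1 - z)⁻¹) ^ p.2) =Θ[𝓝[deltaDomain ϑ r] 1]
      fun z => (-Real.log ‖1 - z‖) ^ p.2.re := by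
    refine (Complex.isTheta_cpow_const_rpow fun _ _ => hL0).trans ?_
    exact hL.norm_left.rpow (Eventually.of_forall fun z => norm_nonneg _)
      (hT.eventually_ge_atTop 0)
  exact h1.mul h2

theorem scaleSize_isLittleO_of_re_lt {p q : ℂ × ℂ} (h : q.1.re < p.1.re) :
    scaleSize q =o[atTop] scaleSize p := by
  have h1 := isLittleO_rpow_exp_pos_mul_atTop (q.2.re - p.2.re) (sub_pos.2 h)
  have h2 := h1.mul_isBigO (isBigO_refl (fun T : ℝ => Real.exp (q.1.re * T) * T ^ p.2.re) atTop)
  refine h2.congr' ?_ ?_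
  · filter_upwards [eventually_gt_atTop 0] with T hT
    rw [scaleSize, Real.rpow_sub hT]
    have := (Real.rpow_pos_of_pos hT p.2.re).ne'
    field_simp
  · refine Eventually.of_forall fun T => ?_
    simp only [scaleSize]
    rw [← mul_assoc, ← Real.exp_add]
    congr 2; ring

theorem isLittleO_rpow_rpow_atTop {a b : ℝ} (h : a < b) :
    (fun T : ℝ => T ^ a) =o[atTop] fun T => T ^ b := by
  refine isLittleO_of_tendsto' ?_ ?_
  · filter_upwards [eventually_gt_atTop 0] with T hT h0
    exact absurd h0 (Real.rpow_pos_of_pos hT b).ne'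
  · refine (tendsto_rpow_neg_atTop (sub_pos.2 h)).congr' ?_
    filter_upwards [eventually_gt_atTop 0] with T hT
    rw [neg_sub, Real.rpow_sub hT]

/-- Growth is governed by the lexicographic order on the real parts of the two exponents, a total
preorder. -/
theorem scaleSize_isLittleO_or_isBigO (p q : ℂ × ℂ) :
    scaleSize q =o[atTop] scaleSize p ∨ scaleSize p =O[atTop] scaleSize q := by
  rcases lt_trichotomy q.1.re p.1.re with h | h | h
  · exact Or.inl (scaleSize_isLittleO_of_re_lt h)
  · rcases lt_or_ge q.2.re p.2.re with h' | h'
    · left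
      have := (isBigO_refl (fun T : ℝ => Real.exp (q.1.re * T)) atTop).mul_isLittleO
        (isLittleO_rpow_rpow_atTop h')
      unfold scaleSize
      rwa [h] at this ⊢
    · right
      refine IsBigO.of_bound 1 ?_
      filter_upwards [eventually_ge_atTop 1] with T hT
      have h0 : 0 ≤ T := by linarith
      simp only [scaleSize, norm_mul, Real.norm_eq_abs, Real.abs_exp, one_mul, h,
        abs_of_nonneg (Real.rpow_nonneg h0 _)]
      gcongr
  · exact Or.inr (scaleSize_isLittleO_of_re_lt h).isBigO

theorem scale_isLittleO_of_re_lt (h0 : 0 < ϑ) {p q : ℂ × ℂ} (h : q.1.re < p.1.re) :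
    scale q =o[𝓝[deltaDomain ϑ r] 1] scale p :=
  ((isTheta_scale h0 q).isLittleO_congr_left.2 ((isTheta_scale h0 p).isLittleO_congr_right.2
    ((scaleSize_isLittleO_of_re_lt h).comp_tendsto tendsto_neg_log_norm_one_sub)))

theorem scale_isBigO_of_not_dominates (h0 : 0 < ϑ) {p q : ℂ × ℂ}
    (h : ¬ Dominates (deltaDomain ϑ r) p q) : scale p =O[𝓝[deltaDomain ϑ r] 1] scale q := by
  rcases scaleSize_isLittleO_or_isBigO p q with h' | h'
  · exact absurd ((isTheta_scale h0 q).isLittleO_congr_left.2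
      ((isTheta_scale h0 p).isLittleO_congr_right.2
        (h'.comp_tendsto tendsto_neg_log_norm_one_sub))) h
  · exact (isTheta_scale h0 p).isBigO_congr_left.2 ((isTheta_scale h0 q).isBigO_congr_right.2
        (h'.comp_tendsto tendsto_neg_log_norm_one_sub))

theorem not_dominates_of_re_lt (h0 : 0 < ϑ) (hϑ : ϑ < Real.pi) (hr : 1 < r) {p q : ℂ × ℂ}
    (h : p.1.re < q.1.re) : ¬ Dominates (deltaDomain ϑ r) p q := by
  intro hd
  have := neBot_nhdsWithin_deltaDomain hϑ hr
  have h1 : scale q =o[𝓝[deltaDomain ϑ r] 1] scale q :=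
    IsLittleO.trans hd (scale_isLittleO_of_re_lt h0 h)
  have h2 : (fun z => scaleSize q (-Real.log ‖1 - z‖)) =o[𝓝[deltaDomain ϑ r] 1]
      fun z => scaleSize q (-Real.log ‖1 - z‖) :=
    (isTheta_scale h0 q).isLittleO_congr_left.1 ((isTheta_scale h0 q).isLittleO_congr_right.1 h1)
  refine isLittleO_irrefl (Eventually.frequently ?_) h2
  filter_upwards [(tendsto_neg_log_norm_one_sub (ϑ := ϑ) (r := r)).eventually_gt_atTop 0] with z hz
  exact mul_ne_zero (Real.exp_ne_zero _) (Real.rpow_pos_of_pos hz _).ne'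

/-! ### Calculus of singular expansions. -/

theorem HasSingularExpansion.congr {D : Set ℂ} {F G : ℂ → ℂ} {c : ℂ × ℂ → ℂ}
    (h : HasSingularExpansion F D c) (he : F =ᶠ[𝓝[D] 1] G) : HasSingularExpansion G D c := by
  intro ω
  obtain ⟨T, hT, hO⟩ := h ω
  refine ⟨T, hT, hO.congr' ?_ EventuallyEq.rfl⟩
  filter_upwards [he] with z hz
  rw [hz]

theorem HasSingularExpansion.add {D : Set ℂ} {F G : ℂ → ℂ} {c d : ℂ × ℂ → ℂ}
    (hF : HasSingularExpansion F D c) (hG : HasSingularExpansion G D d) :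
    HasSingularExpansion (fun z => F z + G z) D (fun p => c p + d p) := by
  classical
  intro ω
  obtain ⟨S, hS, hSO⟩ := hF ω
  obtain ⟨T, hT, hTO⟩ := hG ω
  -- Coefficients may cancel in the sum, so the vanishing ones are removed.
  refine ⟨(S ∪ T).filter fun p => c p + d p ≠ 0, fun p => ?_, ?_⟩
  · rw [Finset.mem_filter, Finset.mem_union, hS, hT]
    constructor
    · rintro ⟨h | h, hn⟩
      · exact ⟨hn, h.2⟩
      · exact ⟨hn, h.2⟩
    · rintro ⟨hn, hd⟩
      refine ⟨?_, hn⟩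
      by_cases hc : c p = 0
      · exact Or.inr ⟨fun h => hn (by simp only [hc, h, add_zero]), hd⟩
      · exact Or.inl ⟨hc, hd⟩
  · refine (hSO.add hTO).congr_left fun z => ?_
    have hdom : ∀ p ∈ S ∪ T, Dominates D p ω := fun p hp => by
      rcases Finset.mem_union.1 hp with h | h
      · exact ((hS p).1 h).2
      · exact ((hT p).1 h).2
    have h1 : ∑ p ∈ S, c p * scale p z = ∑ p ∈ S ∪ T, c p * scale p z := by
      refine Finset.sum_subset Finset.subset_union_left fun p hp hpS => ?_
      have : c p = 0 := by
        by_contra hc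
        exact hpS ((hS p).2 ⟨hc, hdom p hp⟩)
      rw [this, zero_mul]
    have h2 : ∑ p ∈ T, d p * scale p z = ∑ p ∈ S ∪ T, d p * scale p z := by
      refine Finset.sum_subset Finset.subset_union_right fun p hp hpT => ?_
      have : d p = 0 := by
        by_contra hc
        exact hpT ((hT p).2 ⟨hc, hdom p hp⟩)
      rw [this, zero_mul]
    have h3 : ∑ p ∈ (S ∪ T).filter (fun p => c p + d p ≠ 0), (c p + d p) * scale p z =
        ∑ p ∈ S ∪ T, (c p + d p) * scale p z := by
      refine Finset.sum_filter_of_ne fun p _ hp h => hp ?_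
      rw [h, zero_mul]
    rw [h1, h2, h3]
    simp only [add_mul, Finset.sum_add_distrib]
    ring

theorem hasSingularExpansion_zero (D : Set ℂ) :
    HasSingularExpansion (fun _ => 0) D (fun _ => 0) := fun ω =>
  ⟨∅, by simp, by simpa using isBigO_zero _ _⟩

theorem scale_shift {p : ℂ × ℂ} {z : ℂ} (hz : 1 - z ≠ 0) (m : ℕ) :
    scale (p.1 - m, p.2) z = (1 - z) ^ m * scale p z := by
  simp only [scale]
  rw [show -(p.1 - (m : ℂ)) = m + -p.1 by ring, Complex.cpow_add _ _ hz,
    Complex.cpow_natCast, mul_assoc]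

/-- Multiplication by `(1 - z) ^ m` shifts the first exponent by `-m`, so the Taylor coefficients of
`h` are the coefficients of the expansion, carried by the points `(p.1 - m, p.2)`. -/
theorem exists_hasSingularExpansion_mul_scale (h0 : 0 < ϑ) (hϑ : ϑ < Real.pi) (hr : 1 < r)
    {h : ℂ → ℂ} (hh : AnalyticAt ℂ h 0) (p : ℂ × ℂ) :
    ∃ c, HasSingularExpansion (fun z => h (1 - z) * scale p z) (deltaDomain ϑ r) c := by
  classical
  obtain ⟨P, hP⟩ := hh
  set e : ℕ → ℂ × ℂ := fun m => (p.1 - m, p.2) with he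
  have hinj : Function.Injective e := fun m n hmn => by
    have : p.1 - (m : ℂ) = p.1 - n := congrArg Prod.fst hmn
    exact_mod_cast sub_right_injective this
  set c : ℂ × ℂ → ℂ := Function.extend e P.coeff 0 with hc
  have hce : ∀ m, c (e m) = P.coeff m := fun m => hinj.extend_apply _ _ _
  refine ⟨c, fun ω => ?_⟩
  -- From index `N` on every term is negligible against `ω`, including the Taylor remainder.
  obtain ⟨N, hN⟩ := exists_nat_gt (p.1.re - ω.1.re)
  have hlt : ∀ m, N ≤ m → (e m).1.re < ω.1.re := fun m hm => by
    have : (N : ℝ) ≤ m := by exact_mod_cast hm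
    simp [he]; linarith
  set S := (Finset.range N).image e with hS
  refine ⟨S.filter fun q => c q ≠ 0 ∧ Dominates (deltaDomain ϑ r) q ω, fun q => ?_, ?_⟩
  · rw [Finset.mem_filter, and_iff_right_iff_imp]
    rintro ⟨hq, hd⟩
    by_cases hqe : ∃ m, e m = q
    · obtain ⟨m, rfl⟩ := hqe
      refine Finset.mem_image_of_mem _ (Finset.mem_range.2 ?_)
      by_contra! hm
      exact not_dominates_of_re_lt h0 hϑ hr (hlt m hm) hd
    · exact absurd (Function.extend_apply' _ _ _ hqe) hq
  · have hrem : (fun z => (h (1 - z) - ∑ m ∈ Finset.range N, P.coeff m * (1 - z) ^ m) * scale p z)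
        =O[𝓝[deltaDomain ϑ r] 1] scale ω := by
      have hT := (hP.isBigO_sub_partialSum_pow N).comp_tendsto
        (tendsto_one_sub_deltaDomain (ϑ := ϑ) (r := r)|>.mono_right nhdsWithin_le_nhds)
      have hT' : (fun z => h (1 - z) - ∑ m ∈ Finset.range N, P.coeff m * (1 - z) ^ m)
          =O[𝓝[deltaDomain ϑ r] 1] fun z => (1 - z) ^ N := by
        refine (hT.congr_left fun z => ?_).trans (IsBigO.of_bound (1 : ℝ)
          (Eventually.of_forall fun z => by simp))
        simp only [Function.comp_apply, zero_add, FormalMultilinearSeries.partialSum]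
        congr 1
        refine Finset.sum_congr rfl fun m _ => ?_
        rw [FormalMultilinearSeries.apply_eq_pow_smul_coeff, smul_eq_mul, mul_comm]
      refine ((hT'.mul (isBigO_refl (scale p) _)).congr' EventuallyEq.rfl ?_).trans
        (scale_isLittleO_of_re_lt h0 (hlt N le_rfl)).isBigO
      filter_upwards [self_mem_nhdsWithin] with z hz
      exact (scale_shift (sub_ne_zero.2 hz.2.1.symm) N).symm
    have hsmall : (fun z => ∑ q ∈ S.filter (fun q => ¬ (c q ≠ 0 ∧
        Dominates (deltaDomain ϑ r) q ω)), c q * scale q z)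
        =O[𝓝[deltaDomain ϑ r] 1] scale ω := by
      refine IsBigO.fun_sum fun q hq => ?_
      have hq := (Finset.mem_filter.1 hq).2
      by_cases hcq : c q = 0
      · simp only [hcq, zero_mul]
        exact isBigO_zero _ _
      · exact (scale_isBigO_of_not_dominates h0 fun hd => hq ⟨hcq, hd⟩).const_mul_left _
    refine (hrem.add hsmall).congr' ?_ EventuallyEq.rfl
    filter_upwards [self_mem_nhdsWithin] with z hz
    have hz' : 1 - z ≠ 0 := sub_ne_zero.2 hz.2.1.symm
    have hsum : ∑ q ∈ S, c q * scale q z =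
        (∑ m ∈ Finset.range N, P.coeff m * (1 - z) ^ m) * scale p z := by
      rw [hS, Finset.sum_image hinj.injOn, Finset.sum_mul]
      refine Finset.sum_congr rfl fun m _ => ?_
      rw [hce, he, scale_shift hz', mul_assoc]
    rw [← Finset.sum_filter_add_sum_filter_not S
      (fun q => c q ≠ 0 ∧ Dominates (deltaDomain ϑ r) q ω)] at hsum
    linear_combination hsum

end Domain

theorem exists_hasSingularExpansion_sum {D : Set ℂ} {ι : Type*} (s : Finset ι) {F : ι → ℂ → ℂ}
    (h : ∀ i ∈ s, ∃ c, HasSingularExpansion (F i) D c) :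
    ∃ c, HasSingularExpansion (fun z => ∑ i ∈ s, F i z) D c := by
  classical
  induction s using Finset.induction_on with
  | empty => exact ⟨_, by simpa using hasSingularExpansion_zero D⟩
  | insert a s ha ih =>
    simp only [Finset.sum_insert ha]
    obtain ⟨c, hc⟩ := h a (Finset.mem_insert_self _ _)
    obtain ⟨d, hd⟩ := ih fun i hi => h i (Finset.mem_insert_of_mem hi)
    exact ⟨_, hc.add hd⟩

/-! ### From the coordinate `-log z` to `1 - z`. -/

/-- The unit factor `-log (1 - x) / x`. -/
noncomputable def logUnit : ℂ → ℂ := dslope (fun x => -Complex.log (1 - x)) 0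

theorem analyticAt_logUnit : AnalyticAt ℂ logUnit 0 := by
  have hd : DifferentiableOn ℂ (fun x => -Complex.log (1 - x)) (Metric.ball 0 1) := fun x hx => by
    have : 1 - x ∈ Complex.slitPlane :=
      mem_cutPlane_of_norm_lt_one (mem_ball_zero_iff.1 hx)
    exact (((differentiableAt_id.const_sub 1).clog this).neg).differentiableWithinAt
  exact ((Complex.differentiableOn_dslope (Metric.ball_mem_nhds _ one_pos)).2 hd).analyticAt
    (Metric.ball_mem_nhds _ one_pos)

theorem logUnit_zero : logUnit 0 = 1 := by
  rw [logUnit, dslope_same]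
  have h := (((hasDerivAt_id (0 : ℂ)).const_sub 1).clog (by simp)).neg
  simpa using h.deriv

theorem mul_logUnit (x : ℂ) : x * logUnit x = -Complex.log (1 - x) := by
  have := sub_smul_dslope (fun x => -Complex.log (1 - x)) 0 x
  simpa [logUnit] using this

/-- The sector condition keeps the sum of the arguments within `(-π, π)`, so no `2πi` appears. -/
theorem log_mul_of_arg {ϑ : ℝ} (hϑ : ϑ < Real.pi) {x y : ℂ} (hx0 : x ≠ 0)
    (hy0 : y ≠ 0) (hx : |Complex.arg x| < Real.pi - ϑ ∨ Complex.arg x = 0)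
    (hy : |Complex.arg y| < ϑ) : Complex.log (x * y) = Complex.log x + Complex.log y := by
  refine Complex.log_mul hx0 hy0 ?_
  have h2 := abs_lt.1 hy
  rcases hx with hx | hx
  · have h1 := abs_lt.1 hx
    constructor <;> linarith
  · rw [hx]
    constructor <;> linarith

/-- With `g = logUnit`, Taylor's formula at `log g` gives `Q(log x + log g) = ∑ Q_i(log g) (log x) ^
i`, where `Q_i` is the `i`-th Hasse derivative; all but `(log x) ^ i` is analytic in `x`. -/
theorem exists_hasSingularExpansion {ϑ r : ℝ} (h0 : 0 < ϑ) (hϑ : ϑ < Real.pi) (hr : 1 < r)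
    {β : ℂ} {F : ℂ → ℂ} (hF : HasLogSingularity β (fun w => F (Complex.exp (-w)))) :
    ∃ c, HasSingularExpansion F (deltaDomain ϑ r) c := by
  obtain ⟨H, Q, hH, hu⟩ := hF
  have hg := analyticAt_logUnit
  have hslit : (1 : ℂ) ∈ Complex.slitPlane := Complex.one_mem_slitPlane
  have hlogg : AnalyticAt ℂ (fun x => Complex.log (logUnit x)) 0 :=
    hg.clog (by rwa [logUnit_zero])
  have hpow : AnalyticAt ℂ (fun x => logUnit x ^ β) 0 :=
    hg.cpow analyticAt_const (by rwa [logUnit_zero])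
  have hHg : AnalyticAt ℂ (fun x => H (x * logUnit x)) 0 :=
    AnalyticAt.fun_comp (by simpa using hH) (analyticAt_id.mul hg)
  have hpoly : ∀ P : Polynomial ℂ, AnalyticAt ℂ (fun x => P.eval (Complex.log (logUnit x))) 0 :=
    fun P => by
      simpa using (hlogg.aeval_polynomial P)
  obtain ⟨c, hc⟩ := exists_hasSingularExpansion_mul_scale h0 hϑ hr hHg (0, 0)
  obtain ⟨d, hd⟩ := exists_hasSingularExpansion_sum (D := deltaDomain ϑ r)
    (Finset.range (Q.natDegree + 1))
    -- The factor `(-1) ^ i * (1 - (1 - z)) ^ i` comes from `log x = -z * (1 / z * log x⁻¹)`, with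
    -- `z` written as `1 - x`.
    (F := fun i z => (logUnit (1 - z) ^ β * (Polynomial.hasseDeriv i Q).eval
      (Complex.log (logUnit (1 - z))) * ((-1) ^ i * (1 - (1 - z)) ^ i)) * scale (-β, i) z)
    fun i _ => exists_hasSingularExpansion_mul_scale h0 hϑ hr
      ((hpow.mul (hpoly (Polynomial.hasseDeriv i Q))).mul
        (analyticAt_const.mul ((analyticAt_const.sub analyticAt_id).pow i))) (-β, (i : ℂ))
  refine ⟨_, (hc.add hd).congr ?_⟩
  have hx : Tendsto (fun z : ℂ => 1 - z) (𝓝[deltaDomain ϑ r] 1) (𝓝 0) :=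
    tendsto_one_sub_deltaDomain.mono_right nhdsWithin_le_nhds
  have hgx : Tendsto (fun z : ℂ => logUnit (1 - z)) (𝓝[deltaDomain ϑ r] 1) (𝓝 1) := by
    have := hg.continuousAt.tendsto.comp hx
    rwa [logUnit_zero] at this
  have hargx : ∀ᶠ z : ℂ in 𝓝[deltaDomain ϑ r] 1, |Complex.arg (logUnit (1 - z))| < ϑ := by
    have := ((Complex.continuousAt_arg hslit).tendsto.comp hgx).abs
    rw [Complex.arg_one, abs_zero] at this
    exact this.eventually (gt_mem_nhds h0)
  have hzim : Tendsto (fun z : ℂ => z) (𝓝[deltaDomain ϑ r] 1) (𝓝 1) :=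
    tendsto_id.mono_right nhdsWithin_le_nhds
  have hwt : Tendsto (fun z : ℂ => -Complex.log z) (𝓝[deltaDomain ϑ r] 1) (𝓝 0) := by
    have := ((continuousAt_clog hslit).tendsto.comp hzim).neg
    simpa using this
  have hlogmul : ∀ᶠ z : ℂ in 𝓝[deltaDomain ϑ r] 1, logUnit (1 - z) ≠ 0 ∧
      Complex.log (-Complex.log z) = Complex.log (1 - z) + Complex.log (logUnit (1 - z)) := by
    filter_upwards [self_mem_nhdsWithin, hargx, hgx.eventually_ne one_ne_zero] with z hz h1 h2
    refine ⟨h2, ?_⟩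
    rw [← log_mul_of_arg hϑ (sub_ne_zero.2 hz.2.1.symm) h2
      (arg_one_sub_of_mem_deltaDomain h0 hz) h1, mul_logUnit]
    ring_nf
  have hwslit : ∀ᶠ z : ℂ in 𝓝[deltaDomain ϑ r] 1, -Complex.log z ∈ Complex.slitPlane := by
    filter_upwards [self_mem_nhdsWithin, hargx, hlogmul] with z hz h1 h2
    have hx0 : 1 - z ≠ 0 := sub_ne_zero.2 hz.2.1.symm
    have hw0 : -Complex.log z ≠ 0 := by
      have := mul_ne_zero hx0 h2.1
      rwa [mul_logUnit, sub_sub_cancel] at this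
    refine Complex.mem_slitPlane_iff_arg.2 ⟨?_, hw0⟩
    have him := congrArg Complex.im h2.2
    simp only [Complex.add_im, Complex.log_im] at him
    rw [him]
    have h1' := abs_lt.1 h1
    rcases arg_one_sub_of_mem_deltaDomain h0 hz with h | h
    · have := abs_lt.1 h
      intro h'; linarith
    · rw [h]; intro h'; linarith
  have huz := (tendsto_nhdsWithin_iff.2 ⟨hwt, hwslit⟩).eventually hu
  filter_upwards [self_mem_nhdsWithin, huz, hlogmul, hzim.eventually_ne one_ne_zero,
    hwslit] with z hz h1 h2 hz0 h3
  have hx0 : 1 - z ≠ 0 := sub_ne_zero.2 hz.2.1.symm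
  have hxs := one_sub_mem_slitPlane_of_mem_deltaDomain h0 hz
  rw [neg_neg, Complex.exp_log hz0] at h1
  have hw : (1 - z) * logUnit (1 - z) = -Complex.log z := by
    rw [mul_logUnit, sub_sub_cancel]
  have hwpow : (-Complex.log z) ^ β = (1 - z) ^ β * logUnit (1 - z) ^ β := by
    rw [Complex.cpow_def_of_ne_zero (Complex.slitPlane_ne_zero h3),
      Complex.cpow_def_of_ne_zero hx0, Complex.cpow_def_of_ne_zero h2.1, h2.2, add_mul,
      Complex.exp_add]
  have hlogx : Complex.log (1 - z) = -1 * z * (1 / z * Complex.log (1 - z)⁻¹) := by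
    rw [Complex.log_inv _ (Complex.slitPlane_arg_ne_pi hxs)]
    field_simp
  rw [h1, hw, hwpow, h2.2, ← Polynomial.taylor_eval, Polynomial.eval_eq_sum_range,
    Polynomial.natDegree_taylor, Finset.mul_sum]
  congr 1
  · simp [scale]
  · refine Finset.sum_congr rfl fun i _ => ?_
    rw [Polynomial.taylor_coeff, scale, hlogx]
    simp only [neg_neg, sub_sub_cancel, Complex.cpow_natCast, mul_pow]
    ring

theorem deltaDomain_subset_cutPlane {ϑ r : ℝ} (h0 : 0 < ϑ) : deltaDomain ϑ r ⊆ cutPlane :=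
  fun _ hz => one_sub_mem_slitPlane_of_mem_deltaDomain h0 hz

end SingularityAnalysis

theorem theorem3 (α : ℂ) (k : ℕ) :
    (∀ z : ℂ, ‖z‖ < 1 → Summable (SingularityAnalysis.polylogTerm α k z)) ∧
      SingularityAnalysis.IsSAType (SingularityAnalysis.polylog α k) := by
  refine ⟨fun z hz => SingularityAnalysis.summable_polylogTerm α k hz, ?_⟩
  obtain ⟨F, hFd, hFe, hFs⟩ := SingularityAnalysis.hasPolylogContinuation α k
  have hpi := Real.pi_pos
  have h0 : 0 < Real.pi / 4 := by positivity
  -- Any `ϑ` in `(0, π / 2)` and any `r > 1` would serve, since `F` is holomorphic on the whole cut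
  -- plane.
  refine ⟨Real.pi / 4, 2, h0, by linarith, one_lt_two, F, fun z hz => ?_, hFe,
    SingularityAnalysis.exists_hasSingularExpansion h0 (by linarith) one_lt_two hFs⟩
  exact hFd.analyticAt (SingularityAnalysis.isOpen_cutPlane.mem_nhds
    (SingularityAnalysis.deltaDomain_subset_cutPlane h0 hz))
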